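/- **Setting.** Let $(E_t,\mathcal E_t)_{t\ge 0}$ be measurable spaces, $\eta_0$ a probability measure on $E_0$, $M_{t+1}$ a Markov kernel from $E_t$ to $E_{t+1}$, and $G_t=G_t(y_t,\cdot):E_t\to[0,\infty)$ bounded, not identically zero potentials determined (jointly measurably) by an observation $y_t$ in a measurable space. For an observation sequence $y$, let $$\gamma_t(h)=\mathbb E_{\eta_0}\Big[h(X_t)\prod_{i=0}^{t-1}G_i(y_i,X_i)\Big],\qquad \eta_t(h)=\frac{\gamma_t(h)}{\gamma_t(1)},$$ where $X$ is the Markov chain with initial law $\eta_0$ and transitions $M$, and let $\Phi_{t+1}(\nu)=\Psi_t(\nu)M_{t+1}$ with $\Psi_t(\nu)(dx)=G_t(y_t,x)\,\nu(dx)/\nu(G_t(y_t,\cdot))$. Put $\operatorname{osc}(h)=\sup_{x,x'}|h(x)-h(x')|$ and let $\mathrm{Osc}_1(E)$ be the set of measurable $h:E\to\mathbb R$ with $\operatorname{osc}(h)\le 1$. **Regularity conditions.** * $(G)_u$: $\epsilon_u(G)\in(0,1]$ and $G_t(y_t,x)\ge\epsilon_u(G)\,G_t(y_t,x')$ for all $t$,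 $y_t$ and $x,x'\in E_t$. * $(M)_u^{(m)}$: $m\ge 1$ is an integer, $\epsilon_u(M)\in(0,1)$, and $M_{i+1}\cdots M_{i+m}(x,\cdot)\ge\epsilon_u(M)\,M_{i+1}\cdots M_{i+m}(x',\cdot)$ for all $i\ge 0$ and $x,x'\in E_i$. **Particle filter with intermittent subsampling.** Let $\chi,N_b\ge 1$ be integers and $N=\chi N_b$. Let $Y=(Y_t)_{t\ge0}$ be a random sequence of observations with arbitrary law. Write $\eta^N_t=\frac1N\sum_{k=1}^N\delta_{\xi^k_t}$ for the empirical measure of the particles $\xi_t=(\xi_t^1,\dots,\xi_t^N)$. Given $Y$, the particles $\xi_0$ are i.i.d. with law $\eta_0$. Put $\delta_0=0$, and let $\delta_{t+1}\in\{0,1\}$ be a measurable function of $(\xi_t,Y_{t+1})$. Given $Y$ and $\xi_0,\dots,\xi_t$: * if $\delta_{t+1}=0$, then $\xi_{t+1}^1,\dots,\xi_{t+1}^N$ are i.i.d. with law $\Phi_{t+1}(\eta^N_t)$; * if $\delta_{t+1}=1$, then $N_b$ particles are drawn i.i.d. from $\Phi_{t+1}(\eta^N_t)$ and up-sampled to $N$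 particles. Two ways of up-sampling are allowed (one and the same at all times): each of the $N_b$ particles is repeated $\chi$ times, or $N$ particles are drawn i.i.d. from the empirical measure of the $N_b$ particles. **Theorem.** Suppose that $(G)_u$ and $(M)_u^{(m)}$ hold and that $\mathbb P\{\delta_i=1\}\le q_u$ for all $i\ge 0$, where $0\le q_u\le 2/3$. Then, for either way of up-sampling, every real $p\ge 1$ and all $h_t\in\mathrm{Osc}_1(E_t)$, $t\ge0$, $$\sup_{t\ge 0}\mathbb E\big\{|[\eta_t^N-\eta_t](h_t)|^p\big\}^{1/p}\le\frac{\epsilon_{u,m}\,c(p)^{1/p}}{\sqrt N}\Big(q_u^{1/p}\sqrt\chi+(1-q_u)^{1/p}\Big),$$ where $\eta_t$ is taken for the observation sequence $Y$, the expectation is over the particles and the observations, $$\epsilon_{u,m}=\frac{m\,(2-\epsilon_u(M)\,\epsilon_u(G)^m)}{\epsilon_u(M)^3\,\epsilon_u(G)^{2m-1}},$$ and $c(1)=1$, $c(p)=2^{-p/2}\,p\,\Gamma(p/2)$ for $p>1$. -/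

import Mathlib

open MeasureTheory ProbabilityTheory Finset
open scoped ENNReal NNReal

noncomputable section

namespace ParticleFilter

/-! ### Feynman-Kac models -/

/-- A Feynman-Kac model on the state spaces `E t`: initial distribution `init` (written `η₀`),
Markov transitions `M t` from `E t` to `E (t + 1)` (written `M_{t+1}`), and bounded, non-negative
potentials `x ↦ G t y x` on `E t` determined by the observation `y : Obs t` made at time `t`.
The potentials are not identically zero, so that the normalised model exists. -/
structure Model (E : ℕ → Type*) [∀ t, MeasurableSpace (E t)]
    (Obs : ℕ → Type*) [∀ t, MeasurableSpace (Obs t)] where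
  init : Measure (E 0)
  isProbabilityMeasure_init : IsProbabilityMeasure init
  M : ∀ t, Kernel (E t) (E (t + 1))
  isMarkovKernel_M : ∀ t, IsMarkovKernel (M t)
  G : ∀ t, Obs t → E t → ℝ≥0
  measurable_G : ∀ t, Measurable (fun z : Obs t × E t => G t z.1 z.2)
  bounded_G : ∀ t y, ∃ C : ℝ≥0, ∀ x, G t y x ≤ C
  nonzero_G : ∀ t y, ∃ x, G t y x ≠ 0

attribute [instance] Model.isProbabilityMeasure_init Model.isMarkovKernel_M

/-- The Boltzmann-Gibbs transformation `ν ↦ g(x) ν(dx) / ν(g)`. -/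
def boltzmannGibbs {F : Type*} [MeasurableSpace F] (g : F → ℝ≥0) (ν : Measure F) : Measure F :=
  (∫⁻ x, g x ∂ν)⁻¹ • ν.withDensity (fun x => (g x : ℝ≥0∞))

/-- The one-step Feynman-Kac update `Φ(ν) = Ψ(ν) M`. -/
def update {F F' : Type*} [MeasurableSpace F] [MeasurableSpace F'] (g : F → ℝ≥0)
    (K : Kernel F F') (ν : Measure F) : Measure F' :=
  (boltzmannGibbs g ν).bind K

/-- The empirical measure `(1/N) ∑ₖ δ_{ξᵏ}`. -/
def empirical {F : Type*} [MeasurableSpace F] {N : ℕ} (ξ : Fin N → F) : Measure F :=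
  (N : ℝ≥0∞)⁻¹ • ∑ k, Measure.dirac (ξ k)

section Flow

variable {E : ℕ → Type*} [∀ t, MeasurableSpace (E t)]
  {Obs : ℕ → Type*} [∀ t, MeasurableSpace (Obs t)]

/-- The composite kernel `M_{i,i+n} = M_{i+1} ⋯ M_{i+n}`. -/
def Model.composite (S : Model E Obs) (i : ℕ) : ∀ n, Kernel (E i) (E (i + n))
  | 0 => Kernel.id
  | n + 1 => (S.M (i + n)) ∘ₖ (S.composite i n)

/-- The law on path space of the Markov chain `X` with initial law `η₀` and transitions `M`. -/
def Model.chainLaw (S : Model E Obs) : Measure (∀ t, E t) :=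
  (S.init.map (fun x => (MeasurableEquiv.piUnique (fun s : Iic 0 => E s)).symm x)).bind
    (Kernel.traj (fun t => (S.M t).comap (fun x : (∀ s : Iic t, E s) => x ⟨t, by simp⟩)
      (measurable_pi_apply _)) 0)

/-- The unnormalised prediction model
`γ_t(h) = 𝔼_{η₀}[h(X_t) ∏_{i < t} G_i(X_i)]`, for the observation sequence `y`. -/
def Model.gamma (S : Model E Obs) (y : ∀ t, Obs t) (t : ℕ) : Measure (E t) :=
  (S.chainLaw.withDensity (fun x => ((∏ i ∈ range t, S.G i (y i) (x i) : ℝ≥0) : ℝ≥0∞))).map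
    (fun x => x t)

/-- The normalised prediction model `η_t = γ_t / γ_t(1)`, for the observation sequence `y`. -/
def Model.eta (S : Model E Obs) (y : ∀ t, Obs t) (t : ℕ) : Measure (E t) :=
  (S.gamma y t Set.univ)⁻¹ • S.gamma y t

/-- The regularity condition on the potentials, with constant `εG`. -/
def Model.RegularG (S : Model E Obs) (εG : ℝ) : Prop :=
  0 < εG ∧ εG ≤ 1 ∧ ∀ t y (x x' : E t), εG * S.G t y x' ≤ S.G t y x

/-- The regularity condition on the transitions, with lag `m` and constant `εM`. -/
def Model.RegularM (S : Model E Obs) (m : ℕ) (εM : ℝ) : Prop :=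
  1 ≤ m ∧ 0 < εM ∧ εM < 1 ∧
    ∀ i (x x' : E i), ENNReal.ofReal εM • S.composite i m x' ≤ S.composite i m x

end Flow

/-! ### Sampling -/

/-- The law of an i.i.d. sample of size `n` from `μ`. -/
def iidSample {F : Type*} [MeasurableSpace F] (n : ℕ) (μ : Measure F) : Measure (Fin n → F) :=
  Measure.pi (fun _ => μ)

/-- How `χ * Nb` particles are recovered from `Nb` particles: either each particle is repeated
`χ` times, or `χ * Nb` particles are drawn independently from the empirical measure of the `Nb`
particles. -/
inductive Upsampling
  | replicate
  | resample

/-- The law of the `χ * Nb` particles obtained by drawing an i.i.d. sample of size `Nb` from `μ`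
and up-sampling it. -/
def subsample {F : Type*} [MeasurableSpace F] (χ Nb : ℕ) (μ : Measure F) :
    Upsampling → Measure (Fin (χ * Nb) → F)
  | .replicate => (iidSample Nb μ).map (fun ζ k => ζ k.modNat)
  | .resample => (iidSample Nb μ).bind (fun ζ => iidSample (χ * Nb) (empirical ζ))

section Facts

variable {α F F' : Type*} [MeasurableSpace α] [MeasurableSpace F] [MeasurableSpace F']

lemma measurable_iidSample (n : ℕ) {κ : α → Measure F} (hκ : Measurable κ)
    [∀ a, IsFiniteMeasure (κ a)] : Measurable (fun a => iidSample n (κ a)) := by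
  have : ∀ a, IsFiniteMeasure (iidSample n (κ a)) := fun a => by
    unfold iidSample; infer_instance
  refine Measurable.measure_of_isPiSystem generateFrom_pi.symm isPiSystem_pi ?_ ?_
  · rintro _ ⟨s, hs, rfl⟩
    simp only [iidSample, Measure.pi_pi]
    exact Finset.measurable_prod _ fun i _ => (Measure.measurable_coe (hs i trivial)).comp hκ
  · simp only [iidSample, Measure.pi_univ]
    exact Finset.measurable_prod _ fun i _ => (Measure.measurable_coe MeasurableSet.univ).comp hκ

lemma lintegral_empirical {N : ℕ} (ξ : Fin N → F) {f : F → ℝ≥0∞} (hf : Measurable f) :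
    ∫⁻ x, f x ∂(empirical ξ) = (N : ℝ≥0∞)⁻¹ * ∑ k, f (ξ k) := by
  simp [empirical, lintegral_smul_measure, lintegral_finsetSum_measure, lintegral_dirac' _ hf]

lemma empirical_univ_le {N : ℕ} (ξ : Fin N → F) : empirical ξ Set.univ ≤ 1 := by
  simp [empirical, ENNReal.inv_mul_le_one]

instance {N : ℕ} (ξ : Fin N → F) : IsFiniteMeasure (empirical ξ) :=
  ⟨(empirical_univ_le ξ).trans_lt ENNReal.one_lt_top⟩

lemma measurable_empirical {N : ℕ} : Measurable (fun ξ : Fin N → F => empirical ξ) := by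
  refine Measure.measurable_of_measurable_coe _ fun s hs => ?_
  have : ∀ ξ : Fin N → F, empirical ξ s = (N : ℝ≥0∞)⁻¹ * ∑ k, s.indicator 1 (ξ k) := fun ξ => by
    simp [empirical, Measure.dirac_apply' _ hs]
  simp only [this]
  exact (Finset.measurable_fun_sum _ fun k _ =>
    (measurable_one.indicator hs).comp (measurable_pi_apply k)).const_mul _

lemma update_apply (g : F → ℝ≥0) (hg : Measurable g) (K : Kernel F F') (ν : Measure F)
    {s : Set F'} (hs : MeasurableSet s) :
    update g K ν s = (∫⁻ x, g x ∂ν)⁻¹ * ∫⁻ x, g x * K x s ∂ν := by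
  rw [update, Measure.bind_apply hs K.aemeasurable, boltzmannGibbs, lintegral_smul_measure,
    lintegral_withDensity_eq_lintegral_mul _ (by fun_prop) (K.measurable_coe hs)]
  rfl

lemma update_univ_le (g : F → ℝ≥0) (hg : Measurable g) (K : Kernel F F') [IsMarkovKernel K]
    (ν : Measure F) : update g K ν Set.univ ≤ 1 := by
  rw [update_apply g hg K ν MeasurableSet.univ]
  simp [ENNReal.inv_mul_le_one]

lemma measurable_update {N : ℕ} {g : α → F → ℝ≥0}
    (hg : Measurable (fun z : α × F => g z.1 z.2)) (K : Kernel F F') :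
    Measurable (fun z : α × (Fin N → F) => update (g z.1) K (empirical z.2)) := by
  have hga : ∀ a, Measurable (g a) := fun a => hg.comp measurable_prodMk_left
  have hk : ∀ k : Fin N, Measurable (fun z : α × (Fin N → F) => (g z.1 (z.2 k) : ℝ≥0∞)) :=
    fun k => (hg.comp (measurable_fst.prodMk
      ((measurable_pi_apply k).comp measurable_snd))).coe_nnreal_ennreal
  refine Measure.measurable_of_measurable_coe _ fun s hs => ?_
  have hKs : Measurable fun x => K x s := K.measurable_coe hs
  have : ∀ z : α × (Fin N → F), update (g z.1) K (empirical z.2) s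
      = ((N : ℝ≥0∞)⁻¹ * ∑ k, (g z.1 (z.2 k) : ℝ≥0∞))⁻¹ *
        ((N : ℝ≥0∞)⁻¹ * ∑ k, (g z.1 (z.2 k) : ℝ≥0∞) * K (z.2 k) s) := fun z => by
    have := hga z.1
    rw [update_apply _ (hga _) _ _ hs, lintegral_empirical _ (by fun_prop),
      lintegral_empirical _ (by fun_prop)]
  simp only [this]
  refine Measurable.mul (Measurable.inv ?_) ?_
  · exact (Finset.measurable_fun_sum _ fun k _ => hk k).const_mul _
  · exact (Finset.measurable_fun_sum _ fun k _ => (hk k).mul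
      (hKs.comp ((measurable_pi_apply k).comp measurable_snd))).const_mul _

instance (n : ℕ) (μ : Measure F) [IsFiniteMeasure μ] : IsFiniteMeasure (iidSample n μ) := by
  unfold iidSample; infer_instance

lemma iidSample_univ_le (n : ℕ) {μ : Measure F} (hμ : μ Set.univ ≤ 1) :
    iidSample n μ Set.univ ≤ 1 := by
  have : IsFiniteMeasure μ := ⟨hμ.trans_lt ENNReal.one_lt_top⟩
  simp only [iidSample, Measure.pi_univ, Finset.prod_const]
  exact pow_le_one₀ (zero_le) hμ

lemma measurable_resample (n N : ℕ) :
    Measurable (fun ζ : Fin n → F => iidSample N (empirical ζ)) :=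
  measurable_iidSample N measurable_empirical

lemma measurable_replicate (χ Nb : ℕ) :
    Measurable (fun (ζ : Fin Nb → F) (k : Fin (χ * Nb)) => ζ k.modNat) :=
  measurable_pi_lambda _ fun _ => measurable_pi_apply _

lemma subsample_univ_le (χ Nb : ℕ) (mode : Upsampling) {μ : Measure F} (hμ : μ Set.univ ≤ 1) :
    subsample χ Nb μ mode Set.univ ≤ 1 := by
  cases mode with
  | replicate =>
    rw [subsample, Measure.map_apply (measurable_replicate χ Nb) MeasurableSet.univ]
    simpa using iidSample_univ_le Nb hμ
  | resample =>
    rw [subsample, Measure.bind_apply MeasurableSet.univ (measurable_resample _ _).aemeasurable]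
    calc _ ≤ ∫⁻ _, 1 ∂(iidSample Nb μ) :=
          lintegral_mono fun ζ => iidSample_univ_le _ (empirical_univ_le ζ)
      _ ≤ 1 := by simpa using iidSample_univ_le Nb hμ

lemma measurable_subsample (χ Nb : ℕ) (mode : Upsampling) {κ : α → Measure F}
    (hκ : Measurable κ) [∀ a, IsFiniteMeasure (κ a)] :
    Measurable (fun a => subsample χ Nb (κ a) mode) := by
  cases mode with
  | replicate =>
    exact (Measure.measurable_map _ (measurable_replicate χ Nb)).comp (measurable_iidSample Nb hκ)
  | resample =>
    exact (Measure.measurable_bind' (measurable_resample _ _)).comp (measurable_iidSample Nb hκ)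

end Facts

/-! ### The particle filter with intermittent subsampling -/

section Filter

variable {E : ℕ → Type*} [∀ t, MeasurableSpace (E t)]
  {Obs : ℕ → Type*} [∀ t, MeasurableSpace (Obs t)]

/-- A decision rule: whether to subsample at time `t + 1` is decided from the `N` particles at
time `t` and the observation at time `t + 1`. -/
structure DecisionRule (E : ℕ → Type*) [∀ t, MeasurableSpace (E t)]
    (Obs : ℕ → Type*) [∀ t, MeasurableSpace (Obs t)] (N : ℕ) where
  decision : ∀ t, (Fin N → E t) → Obs (t + 1) → Bool
  measurable_decision :
    ∀ t, Measurable (fun z : (Fin N → E t) × Obs (t + 1) => decision t z.1 z.2)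

/-- The law of the particles at time `t + 1`, given the observations `y` and the particles `x`
at time `t`. -/
def stepLaw (S : Model E Obs) {χ Nb : ℕ} (D : DecisionRule E Obs (χ * Nb)) (mode : Upsampling)
    (t : ℕ) (y : ∀ s, Obs s) (x : Fin (χ * Nb) → E t) : Measure (Fin (χ * Nb) → E (t + 1)) :=
  if D.decision t x (y (t + 1)) = true then
    subsample χ Nb (update (S.G t (y t)) (S.M t) (empirical x)) mode
  else iidSample (χ * Nb) (update (S.G t (y t)) (S.M t) (empirical x))

lemma measurable_update_particles (S : Model E Obs) (N t : ℕ) :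
    Measurable (fun z : (∀ s, Obs s) × (Fin N → E t) =>
      update (S.G t (z.1 t)) (S.M t) (empirical z.2)) := by
  have h1 : Measurable (fun z : Obs t × (Fin N → E t) =>
      update (S.G t z.1) (S.M t) (empirical z.2)) :=
    measurable_update (g := S.G t) (S.measurable_G t) (S.M t)
  have h2 : Measurable (fun z : (∀ s, Obs s) × (Fin N → E t) => (z.1 t, z.2)) :=
    ((measurable_pi_apply t).comp measurable_fst).prodMk measurable_snd
  exact Measurable.comp (g := fun z : Obs t × (Fin N → E t) =>
      update (S.G t z.1) (S.M t) (empirical z.2))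
    (f := fun z : (∀ s, Obs s) × (Fin N → E t) => (z.1 t, z.2)) h1 h2

lemma measurable_stepLaw (S : Model E Obs) {χ Nb : ℕ} (D : DecisionRule E Obs (χ * Nb))
    (mode : Upsampling) (t : ℕ) :
    Measurable (fun z : (∀ s, Obs s) × (Fin (χ * Nb) → E t) => stepLaw S D mode t z.1 z.2) := by
  have hu := measurable_update_particles S (χ * Nb) t
  have hf : ∀ z : (∀ s, Obs s) × (Fin (χ * Nb) → E t),
      IsFiniteMeasure (update (S.G t (z.1 t)) (S.M t) (empirical z.2)) := fun z =>
    ⟨(update_univ_le _ ((S.measurable_G t).comp measurable_prodMk_left) _ _).trans_lt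
      ENNReal.one_lt_top⟩
  refine Measurable.ite ?_ (measurable_subsample χ Nb mode hu) (measurable_iidSample _ hu)
  exact ((D.measurable_decision t).comp (measurable_snd.prodMk
    ((measurable_pi_apply (t + 1)).comp measurable_fst))) (measurableSet_singleton true)

/-- `stepLaw` as a transition kernel from the observations and the particle history. -/
def stepKernel (S : Model E Obs) {χ Nb : ℕ} (D : DecisionRule E Obs (χ * Nb))
    (mode : Upsampling) (t : ℕ) :
    Kernel ((∀ s, Obs s) × (∀ s : Iic t, Fin (χ * Nb) → E s)) (Fin (χ * Nb) → E (t + 1)) where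
  toFun z := stepLaw S D mode t z.1 (z.2 ⟨t, by simp⟩)
  measurable' := (measurable_stepLaw S D mode t).comp
    (measurable_fst.prodMk ((measurable_pi_apply _).comp measurable_snd))

instance (S : Model E Obs) {χ Nb : ℕ} (D : DecisionRule E Obs (χ * Nb)) (mode : Upsampling)
    (t : ℕ) : IsFiniteKernel (stepKernel S D mode t) := by
  refine ⟨1, ENNReal.one_lt_top, fun z => ?_⟩
  have h := update_univ_le _ ((S.measurable_G t).comp (measurable_prodMk_left (x := z.1 t)))
    (S.M t) (empirical (z.2 ⟨t, by simp⟩))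
  change stepLaw S D mode t z.1 (z.2 ⟨t, by simp⟩) Set.univ ≤ 1
  unfold stepLaw
  split_ifs
  · exact subsample_univ_le χ Nb mode h
  · exact iidSample_univ_le _ h

/-- `ξ` is the particle filter with intermittent subsampling driven by the observations `Y`:
given all observations, `ξ 0` is an i.i.d. sample from the initial distribution, and, given all
observations and `ξ 0, …, ξ t`, the particles `ξ (t + 1)` have the law `stepLaw`. -/
structure IsFilter {Ω : Type*} [MeasurableSpace Ω] (P : Measure Ω) (S : Model E Obs)
    {χ Nb : ℕ} (D : DecisionRule E Obs (χ * Nb)) (mode : Upsampling)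
    (Y : ∀ t, Ω → Obs t) (ξ : ∀ t, Ω → Fin (χ * Nb) → E t) : Prop where
  measurable_obs : ∀ t, Measurable (Y t)
  measurable_particles : ∀ t, Measurable (ξ t)
  law_zero : P.map (fun ω => ((fun t => Y t ω), ξ 0 ω)) =
    (P.map (fun ω t => Y t ω)).prod (iidSample (χ * Nb) S.init)
  law_succ : ∀ t, P.map (fun ω => (((fun s => Y s ω), (fun s : Iic t => ξ s ω)), ξ (t + 1) ω)) =
    (P.map (fun ω => ((fun s => Y s ω), (fun s : Iic t => ξ s ω)))) ⊗ₘ stepKernel S D mode t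

/-- The indicator `δ_t` of subsampling at time `t`; there is none at time `0`. -/
def subsampled {Ω : Type*} {N : ℕ} (D : DecisionRule E Obs N)
    (Y : ∀ t, Ω → Obs t) (ξ : ∀ t, Ω → Fin N → E t) : ℕ → Ω → Bool
  | 0, _ => false
  | t + 1, ω => D.decision t (ξ t ω) (Y (t + 1) ω)

end Filter

/-! ### Test functions and constants -/

/-- The oscillation `sup_{x, y} |h x - h y|`. -/
def osc {F : Type*} (h : F → ℝ) : ℝ≥0∞ := ⨆ x, ⨆ y, ENNReal.ofReal |h x - h y|

/-- Measurable functions with oscillation at most one. -/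
def Osc1 (F : Type*) [MeasurableSpace F] : Set (F → ℝ) := {h | Measurable h ∧ osc h ≤ 1}

/-- The constants `c(p)`. -/
def cConst (p : ℝ) : ℝ := if p = 1 then 1 else (2 : ℝ) ^ (-p / 2) * p * Real.Gamma (p / 2)

/-- The constant `ε_{u,m} = m (2 - εM εG^m) / (εM³ εG^{2m-1})`. -/
def epsConst (m : ℕ) (εM εG : ℝ) : ℝ :=
  m * (2 - εM * εG ^ m) / (εM ^ 3 * εG ^ (2 * m - 1))

end ParticleFilter

end

/-! Fix an observation sequence and let Φ_{q,n} be the normalised Feynman-Kac semigroup from time q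
to time n (`Model.ratio`). The error at time n telescopes into the local errors Φ_{q,n}(η_q^N)(h) −
Φ_{q−1,n}(η_{q−1}^N)(h) for 1 ≤ q ≤ n, together with Φ_{0,n}(η_0^N)(h) − Φ_{0,n}(η_0)(h). By
`ratio_update` the subtracted term is Φ_{q,n}(μ)(h) with μ = Φ_q(η_{q−1}^N), the law from which the
particles at time q are drawn given the observations and the past. By Minkowski's inequality it is
enough to bound each local error in L^p by a quantity that decays geometrically in n − q.

Deterministic half: `ratio_sub_ratio_le` bounds the local error by (εM εG^m)⁻¹ |η_q^N(f)|, where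
μ(f) = 0 and the values of f lie in an interval of length at most (1 − ρ)^⌊(n−q)/m⌋, with ρ = εM²
εG^(m−1). The prefactor controls the relative variation of the total mass (`mul_mass_le`); the
geometric factor comes from a Doeblin argument on blocks of m steps (`exists_ratio_bounds`).

Probabilistic half: by Hoeffding's lemma η_q^N(f) is sub-Gaussian. Its parameter is a quarter of the
squared range times 1/N for a full sample, and times at most 1/N + 1/N_b = (1 + χ)/N after
subsampling, for both ways of up-sampling. The decision to subsample is a function of the
observations and the past, so the p-th moment is bounded by a mixture of the two cases with weights
q_u and 1 − q_u. `mixture_moment_le` bounds this mixture by c(p)(q_u^{1/p}√χ + (1 − q_u)^{1/p})^p,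
up to scaling; for p > 2 the condition q_u ≤ 2/3 is what removes the extra 1 in 1 + χ.

Summing the geometric factors over q gives at most m/ρ, and (εM εG^m)⁻¹ m/ρ = m/(εM³ εG^(2m−1)) ≤
ε_{u,m}. -/

noncomputable section

namespace ParticleFilter

/-! ### Moments of sub-Gaussian variables -/

section Moments

variable {Ω : Type*} [MeasurableSpace Ω] {μ : Measure Ω} {Z : Ω → ℝ} {c : ℝ≥0}

/-- Compare terms of order t² as t → 0: 2 + t²Z² ≤ 2 cosh(tZ), whose expectation is at most 2
exp(ct²/2) = 2 + ct² + O(t⁴). Integrating the tail bound would give 4c instead of c. -/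
lemma integral_sq_le_of_hasSubgaussianMGF [IsProbabilityMeasure μ]
    (h : HasSubgaussianMGF Z c μ) : ∫ ω, Z ω ^ 2 ∂μ ≤ c := by
  have key : ∀ t : ℝ, 0 < t → c * t ^ 2 / 2 ≤ 1 → ∫ ω, Z ω ^ 2 ∂μ ≤ c + c ^ 2 * t ^ 2 / 2 := by
    intro t ht ht1
    have h1 := h.integrable_exp_mul t
    have h2 := h.integrable_exp_mul (-t)
    have h3 : Integrable (fun ω => Z ω ^ 2) μ := (h.memLp 2).integrable_sq
    have h4 : ∫ ω, (2 + t ^ 2 * Z ω ^ 2) ∂μ ≤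
        ∫ ω, (Real.exp (t * Z ω) + Real.exp (-t * Z ω)) ∂μ := by
      refine integral_mono ((integrable_const _).add (h3.const_mul _)) (h1.add h2) fun ω => ?_
      have : 1 + (t * Z ω) ^ 2 / 2 ≤ Real.cosh (t * Z ω) := by
        have e : Real.cosh (t * Z ω) = 1 + 2 * Real.sinh (t * Z ω / 2) ^ 2 := by
          have := Real.cosh_two_mul (t * Z ω / 2)
          have := Real.cosh_sq (t * Z ω / 2)
          rw [show 2 * (t * Z ω / 2) = t * Z ω by ring] at *
          linarith
        have : (t * Z ω / 2) ^ 2 ≤ Real.sinh (t * Z ω / 2) ^ 2 := by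
          rw [sq_le_sq, Real.abs_sinh]
          exact Real.self_le_sinh_iff.2 (abs_nonneg _)
        rw [e]; nlinarith
      rw [Real.cosh_eq] at this
      simp only [neg_mul]
      nlinarith
    rw [integral_add h1 h2, integral_add (integrable_const _) (h3.const_mul _),
      integral_const_mul] at h4
    have m1 := h.mgf_le t
    have m2 := h.mgf_le (-t)
    simp only [mgf] at m1 m2
    rw [neg_sq] at m2
    have h5 : Real.exp (c * t ^ 2 / 2) ≤ 1 + c * t ^ 2 / 2 + (c * t ^ 2 / 2) ^ 2 := by
      have := Real.abs_exp_sub_one_sub_id_le (x := c * t ^ 2 / 2)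
        (by rw [abs_of_nonneg (by positivity)]; exact ht1)
      linarith [le_abs_self (Real.exp (c * t ^ 2 / 2) - 1 - c * t ^ 2 / 2)]
    have h6 : t ^ 2 * ∫ ω, Z ω ^ 2 ∂μ ≤ t ^ 2 * (c + c ^ 2 * t ^ 2 / 2) := by
      simp only [integral_const, probReal_univ, one_smul] at h4
      nlinarith
    exact le_of_mul_le_mul_left h6 (by positivity)
  refine le_of_forall_pos_le_add fun ε hε => ?_
  have hc : (0 : ℝ) ≤ c := c.2
  -- `s` plays the part of t²: it makes both cs/2 ≤ 1 and c²s/2 ≤ ε.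
  set s := min ε 1 / (1 + (c : ℝ) + c ^ 2) with hs
  have hs0 : 0 < s := by positivity
  have e : s * (1 + (c : ℝ) + c ^ 2) = min ε 1 := by rw [hs]; field_simp
  have h1 : min ε 1 ≤ 1 := min_le_right _ _
  have h2 : min ε 1 ≤ ε := min_le_left _ _
  have hsq : √s ^ 2 = s := Real.sq_sqrt hs0.le
  refine (key (√s) (Real.sqrt_pos.2 hs0) ?_).trans ?_ <;> rw [hsq] <;>
    nlinarith [mul_nonneg hs0.le hc, mul_nonneg hs0.le (sq_nonneg (c : ℝ))]

/-- The constant in the bound of the `p`-th absolute moment of a sub-Gaussian variable. -/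
def subgaussianConst (p : ℝ) : ℝ :=
  if p ≤ 2 then 1 else 2 ^ (p / 2) * p * Real.Gamma (p / 2)

lemma subgaussianConst_nonneg {p : ℝ} (hp : 1 ≤ p) : 0 ≤ subgaussianConst p := by
  unfold subgaussianConst
  split_ifs
  · exact zero_le_one
  · have := Real.Gamma_pos_of_pos (s := p / 2) (by linarith)
    positivity

/-- Layer-cake formula with the two-sided Chernoff tail 2 exp(−ε²/(2c)); the resulting Gaussian
integral is a Gamma value. -/
lemma lintegral_rpow_le_of_tail [IsProbabilityMeasure μ] (h : HasSubgaussianMGF Z c μ)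
    (hc : 0 < c) {p : ℝ} (hp : 1 ≤ p) :
    ∫⁻ ω, ENNReal.ofReal (|Z ω| ^ p) ∂μ ≤
      ENNReal.ofReal (2 ^ (p / 2) * p * Real.Gamma (p / 2) * (c : ℝ) ^ (p / 2)) := by
  have hp0 : 0 < p := by linarith
  have hc' : (0 : ℝ) < c := hc
  have hG := Real.Gamma_pos_of_pos (s := p / 2) (by linarith)
  have tail : ∀ ε : ℝ, 0 ≤ ε →
      μ {ω | ε ≤ |Z ω|} ≤ ENNReal.ofReal (2 * Real.exp (-(1 / (2 * c)) * ε ^ (2 : ℝ))) := by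
    intro ε hε
    have h1 := h.measure_ge_le hε
    have h2 := h.neg.measure_ge_le hε
    have e : -ε ^ 2 / (2 * c) = -(1 / (2 * c)) * ε ^ (2 : ℝ) := by
      rw [Real.rpow_two]; field_simp
    rw [e] at h1 h2
    rw [← ENNReal.ofReal_toReal (measure_ne_top μ _)]
    refine ENNReal.ofReal_le_ofReal ?_
    have hs : {ω | ε ≤ |Z ω|} ⊆ {ω | ε ≤ Z ω} ∪ {ω | ε ≤ (-Z) ω} := fun ω hω => by
      simpa [le_abs] using hω
    calc μ.real {ω | ε ≤ |Z ω|} ≤ _ := measureReal_mono hs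
      _ ≤ _ := measureReal_union_le _ _
      _ ≤ _ := by linarith
  rw [lintegral_rpow_eq_lintegral_meas_le_mul μ (ae_of_all _ fun ω => abs_nonneg _)
    h.aemeasurable.abs hp0]
  have hint := integrableOn_rpow_mul_exp_neg_mul_rpow (p := 2) (s := p - 1) (b := 1 / (2 * c))
    (by linarith) (by norm_num) (by positivity)
  calc _ ≤ ENNReal.ofReal p * ∫⁻ t in Set.Ioi (0 : ℝ),
        ENNReal.ofReal (2 * (t ^ (p - 1) * Real.exp (-(1 / (2 * c)) * t ^ (2 : ℝ)))) := by
        gcongr 1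
        refine setLIntegral_mono' measurableSet_Ioi fun t ht => ?_
        have ht0 : 0 < t := ht
        calc _ ≤ _ := mul_le_mul_left (tail t ht0.le) _
          _ = _ := by
            rw [← ENNReal.ofReal_mul (by positivity)]; congr 1; ring
    _ = ENNReal.ofReal p * ENNReal.ofReal
          (2 * ((1 / (2 * (c : ℝ))) ^ (-(p - 1 + 1) / 2) * (1 / 2) * Real.Gamma ((p - 1 + 1) / 2))) := by
        rw [← integral_rpow_mul_exp_neg_mul_rpow (by norm_num) (by linarith) (by positivity),
          ← integral_const_mul, ofReal_integral_eq_lintegral_ofReal (hint.const_mul 2)]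
        refine (ae_restrict_iff' measurableSet_Ioi).2 (ae_of_all _ fun t ht => ?_)
        have ht0 : 0 < t := ht
        positivity
    _ = _ := by
        rw [← ENNReal.ofReal_mul hp0.le]
        congr 1
        rw [show p - 1 + 1 = p by ring, one_div, Real.inv_rpow (by positivity), neg_div,
          Real.rpow_neg (by positivity), inv_inv, Real.mul_rpow (by norm_num) hc'.le]
        ring

/-- For p ≤ 2 the second moment suffices, by monotonicity of L^p norms; for larger p the tail is
integrated. A zero parameter forces Z = 0 almost everywhere. -/
lemma lintegral_rpow_le_of_hasSubgaussianMGF [IsProbabilityMeasure μ]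
    (h : HasSubgaussianMGF Z c μ) {p : ℝ} (hp : 1 ≤ p) :
    ∫⁻ ω, ENNReal.ofReal (|Z ω| ^ p) ∂μ ≤
      ENNReal.ofReal (subgaussianConst p * (c : ℝ) ^ (p / 2)) := by
  have hp0 : 0 < p := by linarith
  rcases eq_or_lt_of_le (zero_le : 0 ≤ c) with rfl | hc
  · have h0 := h.ae_eq_zero_of_hasSubgaussianMGF_zero
    rw [lintegral_congr_ae (g := 0)]
    · simp
    · filter_upwards [h0] with ω hω
      simp [hω, Real.zero_rpow hp0.ne']
  unfold subgaussianConst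
  split_ifs with hp2
  · have h2 : ∫⁻ ω, ENNReal.ofReal (|Z ω| ^ (2 : ℝ)) ∂μ ≤ ENNReal.ofReal c := by
      have h3 : Integrable (fun ω => Z ω ^ 2) μ := (h.memLp 2).integrable_sq
      simp only [Real.rpow_two, sq_abs]
      rw [← ofReal_integral_eq_lintegral_ofReal h3 (ae_of_all _ fun _ => sq_nonneg _)]
      exact ENNReal.ofReal_le_ofReal (integral_sq_le_of_hasSubgaussianMGF h)
    have e : ∀ q : ℝ, 0 ≤ q → ∀ ω, ENNReal.ofReal (|Z ω| ^ q) = ‖Z ω‖ₑ ^ q := fun q hq ω => by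
      rw [← ENNReal.ofReal_rpow_of_nonneg (abs_nonneg _) hq, Real.enorm_eq_ofReal_abs]
    simp_rw [e p hp0.le]
    simp_rw [e 2 (by norm_num)] at h2
    have h4 := eLpNorm'_le_eLpNorm'_of_exponent_le hp0 hp2 μ h.aestronglyMeasurable
    unfold eLpNorm' at h4
    have h5 := ENNReal.rpow_le_rpow h4 hp0.le
    rw [← ENNReal.rpow_mul, one_div, inv_mul_cancel₀ hp0.ne', ENNReal.rpow_one] at h5
    refine h5.trans ?_
    rw [← ENNReal.rpow_mul, one_mul, ← ENNReal.ofReal_rpow_of_nonneg (NNReal.coe_nonneg c) (by positivity)]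
    rw [show 1 / 2 * p = p / 2 by ring]
    exact ENNReal.rpow_le_rpow h2 (by positivity)
  · exact lintegral_rpow_le_of_tail h hc hp

end Moments

/-! ### Sampling errors are sub-Gaussian -/

section Sampling

variable {F : Type*} [MeasurableSpace F]

/-- The empirical mean `(1/N) ∑ₖ f(ξᵏ)`. -/
def empiricalMean {N : ℕ} (f : F → ℝ) (ξ : Fin N → F) : ℝ := (N : ℝ)⁻¹ * ∑ k, f (ξ k)

lemma measurable_empiricalMean {N : ℕ} {f : F → ℝ} (hf : Measurable f) :
    Measurable (empiricalMean (N := N) f) := by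
  unfold empiricalMean
  fun_prop

lemma integral_empirical {N : ℕ} (ξ : Fin N → F) {f : F → ℝ} (hf : Measurable f) :
    ∫ x, f x ∂(empirical ξ) = empiricalMean f ξ := by
  rw [empirical, integral_smul_measure, integral_finsetSum_measure]
  · simp [empiricalMean, integral_dirac' _ _ hf.stronglyMeasurable]
  · intro k _
    exact (integrable_dirac' hf.stronglyMeasurable (by simp))

instance {N : ℕ} [NeZero N] (ξ : Fin N → F) : IsProbabilityMeasure (empirical ξ) := by
  constructor
  simp [empirical, ENNReal.inv_mul_cancel, NeZero.ne]

instance (n : ℕ) (μ : Measure F) [IsProbabilityMeasure μ] :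
    IsProbabilityMeasure (iidSample n μ) := by
  unfold iidSample; infer_instance

/-- The sub-Gaussian parameter of a variable with range of length `b - a`. -/
abbrev hoeffdingParam (a b : ℝ) : ℝ≥0 := (‖b - a‖₊ / 2) ^ 2

/-- Hoeffding's lemma applies to each centred summand. Parameters add under independence and scale
by N⁻² under averaging. -/
lemma hasSubgaussianMGF_iidSample (N : ℕ) [NeZero N] (μ : Measure F) [IsProbabilityMeasure μ]
    {f : F → ℝ} (hf : Measurable f) {a b : ℝ} (hab : ∀ x, f x ∈ Set.Icc a b) :
    HasSubgaussianMGF (fun x : Fin N → F => empiricalMean f x - ∫ z, f z ∂μ)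
      (hoeffdingParam a b / N) (iidSample N μ) := by
  have h0 := hasSubgaussianMGF_of_mem_Icc (μ := μ) hf.aemeasurable (ae_of_all _ hab)
  set g : F → ℝ := fun z => f z - ∫ z, f z ∂μ with hg
  have hgm : Measurable g := by fun_prop
  have hind : iIndepFun (fun (k : Fin N) (x : Fin N → F) => g (x k)) (iidSample N μ) :=
    iIndepFun_pi (μ := fun _ : Fin N => μ) (X := fun _ => g) fun _ => hgm.aemeasurable
  have h1 : ∀ k ∈ (univ : Finset (Fin N)),
      HasSubgaussianMGF (fun x : Fin N → F => g (x k)) (hoeffdingParam a b) (iidSample N μ) := by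
    intro k _
    refine HasSubgaussianMGF.of_map (Y := fun x : Fin N → F => x k) (X := g)
      (measurable_pi_apply k).aemeasurable ?_
    rw [iidSample, (measurePreserving_eval (fun _ : Fin N => μ) k).map_eq]
    exact h0
  have h2 := (HasSubgaussianMGF.sum_of_iIndepFun hind (s := univ) h1).const_mul (N : ℝ)⁻¹
  have hN : (N : ℝ) ≠ 0 := NeZero.ne _
  have hN' : (N : ℝ≥0) ≠ 0 := NeZero.ne _
  have e : (⟨(N : ℝ)⁻¹ ^ 2, sq_nonneg _⟩ : ℝ≥0) = ((N : ℝ≥0)⁻¹) ^ 2 := NNReal.eq rfl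
  rw [e] at h2
  have h3 : HasSubgaussianMGF (fun x : Fin N → F => (N : ℝ)⁻¹ * ∑ k, g (x k))
    (((N : ℝ≥0)⁻¹) ^ 2 * ∑ _k : Fin N, hoeffdingParam a b) (iidSample N μ) := h2
  convert! h3 using 1
  · ext x
    simp only [hg, empiricalMean, sum_sub_distrib, sum_const, card_univ, Fintype.card_fin,
      nsmul_eq_mul]
    field_simp
  · rw [sum_const, card_univ, Fintype.card_fin, nsmul_eq_mul]
    field_simp

lemma hasSubgaussianMGF_mono {Ω : Type*} [MeasurableSpace Ω] {μ : Measure Ω} {Z : Ω → ℝ}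
    {c d : ℝ≥0} (h : HasSubgaussianMGF Z c μ) (hcd : c ≤ d) : HasSubgaussianMGF Z d μ :=
  ⟨h.integrable_exp_mul, fun t => (h.mgf_le t).trans (Real.exp_le_exp.2 (by gcongr))⟩

lemma lintegral_exp_le_of_hasSubgaussianMGF {Ω : Type*} [MeasurableSpace Ω] {μ : Measure Ω}
    {Z : Ω → ℝ} {c : ℝ≥0} (h : HasSubgaussianMGF Z c μ) (t : ℝ) :
    ∫⁻ ω, ENNReal.ofReal (Real.exp (t * Z ω)) ∂μ ≤ ENNReal.ofReal (Real.exp (c * t ^ 2 / 2)) := by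
  rw [← ofReal_integral_eq_lintegral_ofReal (h.integrable_exp_mul t)
    (ae_of_all _ fun _ => (Real.exp_pos _).le)]
  exact ENNReal.ofReal_le_ofReal (h.mgf_le t)

lemma hasSubgaussianMGF_of_lintegral_exp_le {Ω : Type*} [MeasurableSpace Ω] {μ : Measure Ω}
    {Z : Ω → ℝ} (hZ : Measurable Z) {c : ℝ≥0}
    (h : ∀ t : ℝ, ∫⁻ ω, ENNReal.ofReal (Real.exp (t * Z ω)) ∂μ ≤
      ENNReal.ofReal (Real.exp (c * t ^ 2 / 2))) : HasSubgaussianMGF Z c μ := by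
  have hm : ∀ t : ℝ, Measurable fun ω => Real.exp (t * Z ω) := fun t => by fun_prop
  have hi : ∀ t : ℝ, Integrable (fun ω => Real.exp (t * Z ω)) μ := fun t =>
    (lintegral_ofReal_ne_top_iff_integrable (hm t).aestronglyMeasurable
      (ae_of_all _ fun _ => (Real.exp_pos _).le)).1 ((h t).trans_lt ENNReal.ofReal_lt_top).ne
  refine ⟨hi, fun t => ?_⟩
  have := h t
  rw [← ofReal_integral_eq_lintegral_ofReal (hi t) (ae_of_all _ fun _ => (Real.exp_pos _).le),
    ENNReal.ofReal_le_ofReal_iff (Real.exp_pos _).le] at this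
  exact this

/-- Condition on the first sample ζ. The resampling error around `empiricalMean f ζ` has a
conditional exponential moment bounded uniformly in ζ, so this bound factors out and the parameters
of the two stages add, although the two errors need not be independent. -/
lemma hasSubgaussianMGF_resample (n N : ℕ) [NeZero n] [NeZero N] (μ : Measure F)
    [IsProbabilityMeasure μ] {f : F → ℝ} (hf : Measurable f) {a b : ℝ}
    (hab : ∀ x, f x ∈ Set.Icc a b) :
    HasSubgaussianMGF (fun x : Fin N → F => empiricalMean f x - ∫ z, f z ∂μ)
      (hoeffdingParam a b / N + hoeffdingParam a b / n)
      ((iidSample n μ).bind (fun ζ => iidSample N (empirical ζ))) := by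
  have hm := measurable_empiricalMean (N := N) hf
  have hm' := measurable_empiricalMean (N := n) hf
  refine hasSubgaussianMGF_of_lintegral_exp_le (hm.sub_const _) fun t => ?_
  rw [Measure.lintegral_bind (measurable_resample n N).aemeasurable
    (by fun_prop)]
  have inner : ∀ ζ : Fin n → F, ∫⁻ x, ENNReal.ofReal
      (Real.exp (t * (empiricalMean f x - ∫ z, f z ∂μ))) ∂(iidSample N (empirical ζ)) ≤
      ENNReal.ofReal (Real.exp ((hoeffdingParam a b / N : ℝ≥0) * t ^ 2 / 2)) *
        ENNReal.ofReal (Real.exp (t * (empiricalMean f ζ - ∫ z, f z ∂μ))) := fun ζ => by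
    have h1 := lintegral_exp_le_of_hasSubgaussianMGF
      (hasSubgaussianMGF_iidSample N (empirical ζ) hf hab) t
    rw [integral_empirical ζ hf] at h1
    calc _ = ∫⁻ x, ENNReal.ofReal (Real.exp (t * (empiricalMean f x - empiricalMean f ζ))) *
          ENNReal.ofReal (Real.exp (t * (empiricalMean f ζ - ∫ z, f z ∂μ)))
            ∂(iidSample N (empirical ζ)) := by
          refine lintegral_congr fun x => ?_
          rw [← ENNReal.ofReal_mul (Real.exp_pos _).le, ← Real.exp_add]
          congr 2; ring
      _ = _ := lintegral_mul_const _ (by fun_prop)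
      _ ≤ _ := by gcongr
  calc _ ≤ _ := lintegral_mono inner
    _ = _ := lintegral_const_mul _ (by fun_prop)
    _ ≤ ENNReal.ofReal (Real.exp ((hoeffdingParam a b / N : ℝ≥0) * t ^ 2 / 2)) *
        ENNReal.ofReal (Real.exp ((hoeffdingParam a b / n : ℝ≥0) * t ^ 2 / 2)) :=
      mul_le_mul_right (lintegral_exp_le_of_hasSubgaussianMGF
        (hasSubgaussianMGF_iidSample n μ hf hab) t) _
    _ = _ := by
      rw [← ENNReal.ofReal_mul (Real.exp_pos _).le, ← Real.exp_add]
      congr 2; push_cast; ring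

lemma empiricalMean_replicate {F : Type*} (χ Nb : ℕ) [NeZero χ] (f : F → ℝ) (ζ : Fin Nb → F) :
    empiricalMean f (fun k : Fin (χ * Nb) => ζ k.modNat) = empiricalMean f ζ := by
  have hχ : (χ : ℝ) ≠ 0 := NeZero.ne _
  have e : ∑ k : Fin (χ * Nb), f (ζ k.modNat) = χ * ∑ j, f (ζ j) := by
    rw [← finProdFinEquiv.sum_comp, Fintype.sum_prod_type]
    have : ∀ x y, (finProdFinEquiv (x, y) : Fin (χ * Nb)).modNat = y := fun x y =>
      congrArg Prod.snd (finProdFinEquiv.symm_apply_apply (x, y))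
    simp [this]
  rw [empiricalMean, e, empiricalMean]
  push_cast
  field_simp

/-- The common parameter is that of resampling. Replication does not change empirical means, so it
contributes only the 1/N_b part. -/
lemma hasSubgaussianMGF_subsample (χ Nb : ℕ) [NeZero χ] [NeZero Nb] (mode : Upsampling)
    (μ : Measure F) [IsProbabilityMeasure μ] {f : F → ℝ} (hf : Measurable f) {a b : ℝ}
    (hab : ∀ x, f x ∈ Set.Icc a b) :
    HasSubgaussianMGF (fun x : Fin (χ * Nb) → F => empiricalMean f x - ∫ z, f z ∂μ)
      (hoeffdingParam a b * ((1 + χ) / (χ * Nb : ℕ))) (subsample χ Nb μ mode) := by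
  have hχ : (χ : ℝ≥0) ≠ 0 := NeZero.ne _
  have hN : (Nb : ℝ≥0) ≠ 0 := NeZero.ne _
  have e : hoeffdingParam a b * ((1 + χ) / (χ * Nb : ℕ)) =
      hoeffdingParam a b / (χ * Nb : ℕ) + hoeffdingParam a b / Nb := by
    push_cast; field_simp
  rw [e]
  cases mode with
  | replicate =>
    refine hasSubgaussianMGF_mono (c := hoeffdingParam a b / Nb) ?_ le_add_self
    refine hasSubgaussianMGF_of_lintegral_exp_le
      ((measurable_empiricalMean hf).sub_const _) fun t => ?_
    have := measurable_empiricalMean (N := χ * Nb) hf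
    rw [subsample, lintegral_map (by fun_prop) (measurable_replicate χ Nb)]
    simp only [empiricalMean_replicate]
    exact lintegral_exp_le_of_hasSubgaussianMGF (hasSubgaussianMGF_iidSample Nb μ hf hab) t
  | resample => exact hasSubgaussianMGF_resample Nb (χ * Nb) μ hf hab

lemma lintegral_empiricalMean_rpow_le {N : ℕ} {ν : Measure (Fin N → F)} [IsProbabilityMeasure ν]
    {f : F → ℝ} {a b : ℝ} (hab : a ≤ b) {v : ℝ≥0}
    (h : HasSubgaussianMGF (empiricalMean f) (hoeffdingParam a b * v) ν) {p : ℝ} (hp : 1 ≤ p) :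
    ∫⁻ x, ENNReal.ofReal (|empiricalMean f x| ^ p) ∂ν ≤
      ENNReal.ofReal ((b - a) ^ p * (subgaussianConst p * ((v : ℝ) / 4) ^ (p / 2))) := by
  refine (lintegral_rpow_le_of_hasSubgaussianMGF h hp).trans_eq ?_
  have hb : 0 ≤ b - a := sub_nonneg.2 hab
  have e : ((hoeffdingParam a b * v : ℝ≥0) : ℝ) = (b - a) ^ (2 : ℝ) * (v / 4) := by
    rw [Real.rpow_two]
    push_cast
    rw [Real.norm_of_nonneg hb]
    ring
  rw [e, Real.mul_rpow (by positivity) (by positivity), ← Real.rpow_mul hb]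
  congr 1
  rw [show 2 * (p / 2) = p by ring]
  ring

instance (χ Nb : ℕ) [NeZero Nb] (mode : Upsampling) (μ : Measure F) [IsProbabilityMeasure μ] :
    IsProbabilityMeasure (subsample χ Nb μ mode) := by
  cases mode with
  | replicate =>
    exact Measure.isProbabilityMeasure_map (measurable_replicate χ Nb).aemeasurable
  | resample =>
    constructor
    rw [subsample, Measure.bind_apply MeasurableSet.univ (measurable_resample _ _).aemeasurable]
    simp

end Sampling

/-! ### Comparison of the constants -/

/-- Log-convexity at the midpoint 2 of x and 4 − x gives 1 = Γ(2)² ≤ Γ(x) Γ(4 − x). Since 4 − x lies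
in [2, 3], convexity between Γ(2) = 1 and Γ(3) = 2 gives Γ(4 − x) ≤ 2. -/
lemma one_half_le_Gamma {x : ℝ} (h1 : 1 ≤ x) (h2 : x ≤ 2) : 1 / 2 ≤ Real.Gamma x := by
  have hx : 0 < Real.Gamma x := Real.Gamma_pos_of_pos (by linarith)
  have hy : 0 < Real.Gamma (4 - x) := Real.Gamma_pos_of_pos (by linarith)
  have key := Real.Gamma_mul_add_mul_le_rpow_Gamma_mul_rpow_Gamma (s := x) (t := 4 - x)
    (a := 1 / 2) (b := 1 / 2) (by linarith) (by linarith) (by norm_num) (by norm_num) (by norm_num)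
  rw [show 1 / 2 * x + 1 / 2 * (4 - x) = 2 by ring, Real.Gamma_two, ← Real.mul_rpow hx.le hy.le,
    ← Real.sqrt_eq_rpow] at key
  have h3 : 1 ≤ Real.Gamma x * Real.Gamma (4 - x) := by
    by_contra! h
    have := Real.sqrt_lt_sqrt (by positivity) h
    rw [Real.sqrt_one] at this
    linarith
  have hG3 : Real.Gamma 3 = 2 := by
    rw [show (3 : ℝ) = 2 + 1 by norm_num, Real.Gamma_add_one (by norm_num), Real.Gamma_two, mul_one]
  have h4 : Real.Gamma (4 - x) ≤ 2 := by
    rcases le_or_gt (4 - x) 3 with h | h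
    · have := Real.convexOn_Gamma.2 (Set.mem_Ioi.2 (two_pos (α := ℝ)))
        (Set.mem_Ioi.2 (three_pos (α := ℝ))) (show 0 ≤ 3 - (4 - x) by linarith)
        (show 0 ≤ 4 - x - 2 by linarith) (by ring)
      simp only [smul_eq_mul, Real.Gamma_two, hG3] at this
      rw [show (3 - (4 - x)) * 2 + (4 - x - 2) * 3 = 4 - x by ring] at this
      linarith
    · linarith
  nlinarith

/-- For p ≠ 1, c(p) = 2^{−p/2} · 2Γ(p/2 + 1), and the Gamma value is at least 1/2. -/
lemma rpow_half_le_cConst {p : ℝ} (hp : 1 ≤ p) (hp2 : p ≤ 2) :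
    (1 / 2 : ℝ) ^ (p / 2) ≤ cConst p := by
  unfold cConst
  split_ifs with h
  · exact Real.rpow_le_one (by norm_num) (by norm_num) (by linarith)
  · have hG := one_half_le_Gamma (x := p / 2 + 1) (by linarith) (by linarith)
    rw [Real.Gamma_add_one (by linarith)] at hG
    have e : (1 / 2 : ℝ) ^ (p / 2) = 2 ^ (-p / 2) := by
      rw [one_div, Real.inv_rpow (by norm_num), neg_div, Real.rpow_neg (by norm_num)]
    rw [e]
    have h2 : (0 : ℝ) < 2 ^ (-p / 2) := by positivity
    nlinarith

lemma cConst_nonneg {p : ℝ} (hp : 1 ≤ p) : 0 ≤ cConst p := by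
  unfold cConst
  split_ifs
  · exact zero_le_one
  · have := Real.Gamma_pos_of_pos (s := p / 2) (by linarith)
    positivity

/-- With x^p = q and y^p = 1 − q, superadditivity of s ↦ s^{p/2} bounds the left side by (x²(1 + χ)
+ y²)^{p/2}. The excess x² over x²χ + y² is absorbed by the cross term 2xy√χ of (x√χ + y)², because
x ≤ 2y. -/
lemma mul_rpow_add_le_rpow {p q χ : ℝ} (hp : 2 ≤ p) (hq0 : 0 ≤ q) (hq : q ≤ 2 / 3) (hχ : 1 ≤ χ) :
    q * (1 + χ) ^ (p / 2) + (1 - q) ≤ (q ^ (1 / p) * √χ + (1 - q) ^ (1 / p)) ^ p := by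
  have hp0 : 0 < p := by linarith
  set x := q ^ (1 / p) with hx
  set y := (1 - q) ^ (1 / p) with hy
  have hx0 : 0 ≤ x := by positivity
  have hy0 : 0 ≤ y := Real.rpow_nonneg (by linarith) _
  have hxp : x ^ p = q := by rw [hx, ← Real.rpow_mul hq0, one_div_mul_cancel hp0.ne', Real.rpow_one]
  have hyp : y ^ p = 1 - q := by
    rw [hy, ← Real.rpow_mul (by linarith), one_div_mul_cancel hp0.ne', Real.rpow_one]
  -- On p-th powers this is q ≤ 2^p (1 − q), which follows from q ≤ 2/3 and 2^p ≥ 4.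
  have hxy : x ≤ 2 * y := by
    refine (Real.rpow_le_rpow_iff hx0 (by positivity) hp0).1 ?_
    rw [Real.mul_rpow (by norm_num) hy0, hxp, hyp]
    have : (2 : ℝ) ^ (2 : ℝ) ≤ 2 ^ p := Real.rpow_le_rpow_of_exponent_le (by norm_num) hp
    norm_num at this
    nlinarith
  have hs : 1 ≤ √χ := Real.one_le_sqrt.2 hχ
  have hs2 : √χ ^ 2 = χ := Real.sq_sqrt (by linarith)
  have sq_rpow : ∀ z : ℝ, 0 ≤ z → (z ^ 2) ^ (p / 2) = z ^ p := fun z hz => by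
    rw [← Real.rpow_two, ← Real.rpow_mul hz]; congr 1; ring
  calc q * (1 + χ) ^ (p / 2) + (1 - q)
      = (x ^ 2 * (1 + χ)) ^ (p / 2) + (y ^ 2) ^ (p / 2) := by
        rw [Real.mul_rpow (by positivity) (by positivity), sq_rpow x hx0, sq_rpow y hy0, hxp, hyp]
    _ ≤ (x ^ 2 * (1 + χ) + y ^ 2) ^ (p / 2) :=
        Real.add_rpow_le_rpow_add (by positivity) (by positivity) (by linarith)
    _ ≤ ((x * √χ + y) ^ 2) ^ (p / 2) := by
        refine Real.rpow_le_rpow (by positivity) ?_ (by positivity)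
        have : x * x ≤ x * (2 * y * √χ) :=
          mul_le_mul_of_nonneg_left (by nlinarith) hx0
        nlinarith
    _ = _ := sq_rpow _ (by positivity)

lemma mul_rpow_add_le_rpow' {p q χ : ℝ} (hp : 1 ≤ p) (hq0 : 0 ≤ q) (hq : q ≤ 2 / 3) (hχ : 1 ≤ χ) :
    q * χ ^ (p / 2) + (1 - q) ≤ (q ^ (1 / p) * √χ + (1 - q) ^ (1 / p)) ^ p := by
  have hp0 : 0 < p := by linarith
  have hy0 : 0 ≤ (1 - q) ^ (1 / p) := Real.rpow_nonneg (by linarith) _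
  refine le_trans (le_of_eq ?_) (Real.add_rpow_le_rpow_add (by positivity) hy0 hp)
  rw [Real.mul_rpow (by positivity) (by positivity), ← Real.rpow_mul hq0,
    ← Real.rpow_mul (by linarith), one_div_mul_cancel hp0.ne', Real.rpow_one, Real.rpow_one,
    Real.sqrt_eq_rpow, ← Real.rpow_mul (by linarith)]
  congr 3
  ring

/-- For p ≤ 2 the moment constant 1 leaves room for (1 + χ)/4 ≤ χ/2. For p > 2 the factor
(1/4)^{p/2} turns `subgaussianConst p` into exactly c(p), and the sharper `mul_rpow_add_le_rpow` is
needed. -/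
lemma mixture_moment_le {p q χ : ℝ} (hp : 1 ≤ p) (hq0 : 0 ≤ q) (hq : q ≤ 2 / 3) (hχ : 1 ≤ χ) :
    q * (subgaussianConst p * ((1 + χ) / 4) ^ (p / 2)) +
        (1 - q) * (subgaussianConst p * (1 / 4) ^ (p / 2)) ≤
      cConst p * (q ^ (1 / p) * √χ + (1 - q) ^ (1 / p)) ^ p := by
  have hp0 : 0 < p := by linarith
  have hc := cConst_nonneg hp
  have hq1 : 0 ≤ 1 - q := by linarith
  unfold subgaussianConst
  split_ifs with h2
  · have e1 : ((1 + χ) / 4) ^ (p / 2) ≤ (1 / 2) ^ (p / 2) * χ ^ (p / 2) := by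
      rw [← Real.mul_rpow (by norm_num) (by linarith)]
      exact Real.rpow_le_rpow (by linarith) (by linarith) (by linarith)
    have e2 : (1 / 4 : ℝ) ^ (p / 2) ≤ (1 / 2) ^ (p / 2) :=
      Real.rpow_le_rpow (by norm_num) (by norm_num) (by linarith)
    calc _ ≤ q * (1 * ((1 / 2) ^ (p / 2) * χ ^ (p / 2))) + (1 - q) * (1 * (1 / 2) ^ (p / 2)) := by
          gcongr
      _ = (1 / 2) ^ (p / 2) * (q * χ ^ (p / 2) + (1 - q)) := by ring
      _ ≤ _ := mul_le_mul (rpow_half_le_cConst hp h2) (mul_rpow_add_le_rpow' hp hq0 hq hχ)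
          (by positivity) hc
  · push Not at h2
    have e : (2 : ℝ) ^ (p / 2) * p * Real.Gamma (p / 2) * (1 / 4) ^ (p / 2) = cConst p := by
      rw [cConst, if_neg (by linarith), neg_div, Real.rpow_neg (by norm_num),
        ← Real.inv_rpow (by norm_num)]
      have : (2 : ℝ) ^ (p / 2) * (1 / 4) ^ (p / 2) = 2⁻¹ ^ (p / 2) := by
        rw [← Real.mul_rpow (by norm_num) (by norm_num)]; norm_num
      rw [← this]; ring
    have e1 : ((1 + χ) / 4) ^ (p / 2) = (1 / 4) ^ (p / 2) * (1 + χ) ^ (p / 2) := by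
      rw [← Real.mul_rpow (by norm_num) (by linarith)]; congr 1; ring
    rw [e1, ← mul_assoc (2 ^ (p / 2) * p * Real.Gamma (p / 2)), e]
    calc _ = cConst p * (q * (1 + χ) ^ (p / 2) + (1 - q)) := by ring
      _ ≤ _ := mul_le_mul_of_nonneg_left (mul_rpow_add_le_rpow h2.le hq0 hq hχ) hc

lemma one_le_epsFactor {εM εG : ℝ} {m : ℕ} (hG0 : 0 < εG) (hG1 : εG ≤ 1) (hM0 : 0 < εM)
    (hM1 : εM < 1) : 1 ≤ 2 - εM * εG ^ m := by
  have : εG ^ m ≤ 1 := pow_le_one₀ hG0.le hG1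
  have : 0 < εG ^ m := by positivity
  nlinarith

/-- The exponent is constant on blocks of m consecutive indices, so the sum is at most m times a
geometric series. -/
lemma sum_pow_div_le {ρ : ℝ} (h0 : 0 < ρ) (h1 : ρ ≤ 1) {m : ℕ} (hm : 1 ≤ m) (n : ℕ) :
    ∑ k ∈ range n, (1 - ρ) ^ (k / m) ≤ m / ρ := by
  have hr : 0 ≤ 1 - ρ := by linarith
  have hblock : ∀ l, ∑ k ∈ range (m * l), (1 - ρ) ^ (k / m) = m * ∑ j ∈ range l, (1 - ρ) ^ j := by
    intro l
    induction l with
    | zero => simp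
    | succ l ih =>
      rw [mul_add, mul_one, sum_range_add, ih, sum_range_succ, mul_add]
      congr 1
      rw [sum_congr rfl (g := fun _ => (1 - ρ) ^ l)]
      · simp
      · intro k hk
        rw [Nat.mul_add_div (by omega), Nat.div_eq_of_lt (mem_range.1 hk), add_zero]
  calc _ ≤ ∑ k ∈ range (m * n), (1 - ρ) ^ (k / m) :=
        sum_le_sum_of_subset_of_nonneg
          (range_subset_range.2 (Nat.le_mul_of_pos_left n (by omega)))
          fun _ _ _ => pow_nonneg hr _
    _ = m * ∑ j ∈ range n, (1 - ρ) ^ j := hblock n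
    _ ≤ m * (1 / ρ) := by
        gcongr
        rw [le_div_iff₀ h0]
        have := geom_sum_mul_neg (1 - ρ) n
        rw [sub_sub_cancel] at this
        rw [this]
        linarith [pow_nonneg hr n]
    _ = _ := by ring

/-! ### Backward functions of the Feynman-Kac flow -/

section Backward

variable {E : ℕ → Type*} [∀ t, MeasurableSpace (E t)]
  {Obs : ℕ → Type*} [∀ t, MeasurableSpace (Obs t)]

/-- The backward function `x ↦ 𝔼[h(X_n) ∏_{q ≤ i < n} G_i(X_i) | X_q = x]`, for `q ≤ n`. -/
def Model.backward (S : Model E Obs) (y : ∀ t, Obs t) (n : ℕ) (h : E n → ℝ≥0∞) (q : ℕ) :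
    E q → ℝ≥0∞ :=
  if hq : q ≤ n then Nat.decreasingInduction (motive := fun k _ => E k → ℝ≥0∞)
    (fun k _ f x => S.G k (y k) x * ∫⁻ z, f z ∂(S.M k x)) h hq else 0

variable (S : Model E Obs) (y : ∀ t, Obs t)

lemma backward_self (n : ℕ) (h : E n → ℝ≥0∞) : S.backward y n h n = h := by
  simp [Model.backward]

lemma backward_of_lt {q n : ℕ} (hq : q < n) (h : E n → ℝ≥0∞) (x : E q) :
    S.backward y n h q x = S.G q (y q) x * ∫⁻ z, S.backward y n h (q + 1) z ∂(S.M q x) := by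
  simp only [Model.backward, dif_pos hq.le, dif_pos (Nat.succ_le_of_lt hq)]
  rw [Nat.decreasingInduction_succ_left (motive := fun k _ => E k → ℝ≥0∞) _ _ hq]

lemma measurable_backward {n : ℕ} {h : E n → ℝ≥0∞} (hh : Measurable h) {q : ℕ} (hq : q ≤ n) :
    Measurable fun z : (∀ t, Obs t) × E q => S.backward z.1 n h q z.2 := by
  induction hq using Nat.decreasingInduction with
  | self =>
    simp only [backward_self]
    exact hh.comp measurable_snd
  | of_succ k hk ih =>
    simp only [backward_of_lt S _ hk]
    refine Measurable.mul ?_ ?_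
    · exact ((S.measurable_G k).comp (((measurable_pi_apply k).comp measurable_fst).prodMk
        measurable_snd)).coe_nnreal_ennreal
    · have h1 : Measurable fun w : ((∀ t, Obs t) × E k) × E (k + 1) =>
          S.backward w.1.1 n h (k + 1) w.2 :=
        ih.comp ((measurable_fst.comp measurable_fst).prodMk measurable_snd)
      exact Measurable.lintegral_kernel_prod_right'
        (κ := (S.M k).prodMkLeft (∀ t, Obs t)) h1

lemma measurable_backward_right {n : ℕ} {h : E n → ℝ≥0∞} (hh : Measurable h) {q : ℕ}
    (hq : q ≤ n) : Measurable (S.backward y n h q) :=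
  (measurable_backward S hh hq).comp measurable_prodMk_left

lemma backward_mono {n : ℕ} {h h' : E n → ℝ≥0∞} (hle : h ≤ h') {q : ℕ} (hq : q ≤ n) :
    S.backward y n h q ≤ S.backward y n h' q := by
  induction hq using Nat.decreasingInduction with
  | self => simpa only [backward_self] using hle
  | of_succ k hk ih =>
    intro x
    rw [backward_of_lt S y hk, backward_of_lt S y hk]
    gcongr
    exact ih _

lemma backward_add {n : ℕ} {h h' : E n → ℝ≥0∞} (hh : Measurable h) {q : ℕ} (hq : q ≤ n) :
    S.backward y n (h + h') q = S.backward y n h q + S.backward y n h' q := by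
  induction hq using Nat.decreasingInduction with
  | self => simp only [backward_self]
  | of_succ k hk ih =>
    ext x
    rw [Pi.add_apply, backward_of_lt S y hk, backward_of_lt S y hk, backward_of_lt S y hk, ih]
    simp only [Pi.add_apply]
    rw [lintegral_add_left (measurable_backward_right S y hh hk), mul_add]

lemma backward_const_mul {n : ℕ} {h : E n → ℝ≥0∞} (hh : Measurable h) (c : ℝ≥0∞) {q : ℕ}
    (hq : q ≤ n) (x : E q) :
    S.backward y n (fun z => c * h z) q x = c * S.backward y n h q x := by
  revert x
  induction hq using Nat.decreasingInduction with
  | self => simp only [backward_self, implies_true]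
  | of_succ k hk ih =>
    intro x
    rw [backward_of_lt S y hk, backward_of_lt S y hk]
    simp only [ih]
    rw [lintegral_const_mul _ (measurable_backward_right S y hh hk)]
    ring

/-- The semigroup property, which allows the backward recursion to be cut into blocks of m steps. -/
lemma backward_restart {k n : ℕ} (hk : k ≤ n) (h : E n → ℝ≥0∞) {q : ℕ} (hq : q ≤ k) :
    S.backward y k (S.backward y n h k) q = S.backward y n h q := by
  induction hq using Nat.decreasingInduction with
  | self => rw [backward_self]
  | of_succ i hi ih =>
    ext x
    rw [backward_of_lt S y hi, backward_of_lt S y (hi.trans_le hk), ih]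

instance (i n : ℕ) : IsMarkovKernel (S.composite i n) := by
  induction n with
  | zero => exact inferInstanceAs (IsMarkovKernel Kernel.id)
  | succ n ih => exact inferInstanceAs (IsMarkovKernel (S.M (i + n) ∘ₖ S.composite i n))

lemma lintegral_composite_succ (i n : ℕ) (x : E i) {h : E (i + (n + 1)) → ℝ≥0∞}
    (hh : Measurable h) :
    ∫⁻ z, h z ∂(S.composite i (n + 1) x) =
      ∫⁻ w, ∫⁻ z, h z ∂(S.M (i + n) w) ∂(S.composite i n x) :=
  Kernel.lintegral_comp (S.M (i + n)) (S.composite i n) x hh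

/-- The supremum of the potential at time `i`. -/
def Model.supG (i : ℕ) : ℝ≥0∞ := ⨆ x, (S.G i (y i) x : ℝ≥0∞)

lemma le_supG (i : ℕ) (x : E i) : (S.G i (y i) x : ℝ≥0∞) ≤ S.supG y i :=
  le_iSup (fun x => (S.G i (y i) x : ℝ≥0∞)) x

lemma supG_lt_top (i : ℕ) : S.supG y i < ∞ := by
  obtain ⟨C, hC⟩ := S.bounded_G i (y i)
  exact (iSup_le fun x => ENNReal.coe_le_coe.2 (hC x)).trans_lt ENNReal.coe_lt_top

/-! ### Two-sided bounds on backward functions under the regularity conditions -/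

section Regular

variable {S} {m : ℕ} {εM εG : ℝ}

lemma Model.RegularG.ofReal_mul_le (hG : S.RegularG εG) (t : ℕ) (y : Obs t) (x x' : E t) :
    ENNReal.ofReal εG * S.G t y x' ≤ S.G t y x := by
  rw [← ENNReal.ofReal_coe_nnreal, ← ENNReal.ofReal_coe_nnreal, ← ENNReal.ofReal_mul hG.1.le]
  exact ENNReal.ofReal_le_ofReal (hG.2.2 t y x x')

lemma Model.RegularG.mul_supG_le (hG : S.RegularG εG) (i : ℕ) (x : E i) :
    ENNReal.ofReal εG * S.supG y i ≤ S.G i (y i) x := by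
  rw [Model.supG, ENNReal.mul_iSup]
  exact iSup_le fun x' => hG.ofReal_mul_le i (y i) x x'

lemma Model.RegularG.G_pos (hG : S.RegularG εG) (t : ℕ) (y : Obs t) (x : E t) :
    0 < S.G t y x := by
  obtain ⟨x', hx'⟩ := S.nonzero_G t y
  have h1 : (0 : ℝ) < S.G t y x' := NNReal.coe_pos.2 (pos_iff_ne_zero.2 hx')
  exact NNReal.coe_pos.1 ((mul_pos hG.1 h1).trans_le (hG.2.2 t y x x'))

lemma Model.RegularM.mul_lintegral_le (hM : S.RegularM m εM) (i : ℕ) (x x' : E i)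
    (f : E (i + m) → ℝ≥0∞) :
    ENNReal.ofReal εM * ∫⁻ z, f z ∂(S.composite i m x') ≤ ∫⁻ z, f z ∂(S.composite i m x) := by
  rw [← smul_eq_mul, ← lintegral_smul_measure]
  exact lintegral_mono' (hM.2.2.2 i x x') le_rfl

variable (S) in
-- Replacing the potentials by their suprema decouples them from the chain. The first potential is
-- evaluated at x and kept exactly, so only k of the k + 1 potentials are replaced; this is why ρ
-- contains εG^(m−1) and not εG^m.
lemma backward_le_composite (q k : ℕ) {h : E (q + (k + 1)) → ℝ≥0∞} (hh : Measurable h) (x : E q) :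
    S.backward y (q + (k + 1)) h q x ≤ S.G q (y q) x * (∏ i ∈ range k, S.supG y (q + i + 1)) *
      ∫⁻ z, h z ∂(S.composite q (k + 1) x) := by
  induction k with
  | zero =>
    rw [backward_of_lt S y (by omega), lintegral_composite_succ S q 0 x hh]
    rw [show S.backward y (q + (0 + 1)) h (q + 1) = h from backward_self S y (q + 1) h]
    simp only [range_zero, prod_empty, mul_one]
    have hk : Measurable fun w => ∫⁻ z, h z ∂(S.M q w) := Measurable.lintegral_kernel hh
    rw [show S.composite q 0 = Kernel.id from rfl]
    exact (congrArg _ (Kernel.lintegral_id' hk x).symm).le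
  | succ k ih =>
    have hm := measurable_backward_right S y hh (q := q + (k + 1)) (by omega)
    have hk : Measurable fun w => ∫⁻ z, h z ∂(S.M (q + (k + 1)) w) := Measurable.lintegral_kernel hh
    rw [← backward_restart S y (k := q + (k + 1)) (by omega) h (by omega)]
    refine (ih hm).trans ?_
    rw [prod_range_succ, lintegral_composite_succ S q (k + 1) x hh]
    calc _ ≤ S.G q (y q) x * (∏ i ∈ range k, S.supG y (q + i + 1)) *
          ∫⁻ w, S.supG y (q + k + 1) * ∫⁻ z, h z ∂(S.M (q + (k + 1)) w)
            ∂(S.composite q (k + 1) x) := by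
          gcongr with w
          rw [backward_of_lt S y (by omega),
            show S.backward y (q + (k + 1 + 1)) h (q + (k + 1) + 1) = h from
              backward_self S y (q + (k + 1) + 1) h]
          gcongr
          exact le_supG S y (q + k + 1) w
      _ = _ := by
          rw [lintegral_const_mul _ hk]
          ring

/-- Converse of `backward_le_composite`: each replaced potential is at least εG times its supremum.
-/
lemma composite_le_backward (hG : S.RegularG εG) (q k : ℕ) {h : E (q + (k + 1)) → ℝ≥0∞}
    (hh : Measurable h) (x : E q) :
    ENNReal.ofReal εG ^ k * (S.G q (y q) x * (∏ i ∈ range k, S.supG y (q + i + 1)) *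
      ∫⁻ z, h z ∂(S.composite q (k + 1) x)) ≤ S.backward y (q + (k + 1)) h q x := by
  induction k with
  | zero =>
    rw [backward_of_lt S y (by omega), lintegral_composite_succ S q 0 x hh]
    rw [show S.backward y (q + (0 + 1)) h (q + 1) = h from backward_self S y (q + 1) h]
    simp only [range_zero, prod_empty, mul_one, pow_zero, one_mul]
    have hk : Measurable fun w => ∫⁻ z, h z ∂(S.M q w) := Measurable.lintegral_kernel hh
    rw [show S.composite q 0 = Kernel.id from rfl]
    exact (congrArg _ (Kernel.lintegral_id' hk x)).le
  | succ k ih =>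
    have hm := measurable_backward_right S y hh (q := q + (k + 1)) (by omega)
    have hk : Measurable fun w => ∫⁻ z, h z ∂(S.M (q + (k + 1)) w) := Measurable.lintegral_kernel hh
    rw [← backward_restart S y (k := q + (k + 1)) (by omega) h (by omega)]
    refine le_trans ?_ (ih hm)
    rw [prod_range_succ, lintegral_composite_succ S q (k + 1) x hh]
    calc _ = ENNReal.ofReal εG ^ k * (S.G q (y q) x * (∏ i ∈ range k, S.supG y (q + i + 1)) *
          ∫⁻ w, (ENNReal.ofReal εG * S.supG y (q + k + 1)) * ∫⁻ z, h z ∂(S.M (q + (k + 1)) w)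
            ∂(S.composite q (k + 1) x)) := by
          rw [lintegral_const_mul _ hk]
          ring
      _ ≤ _ := by
          gcongr with w
          rw [backward_of_lt S y (by omega),
            show S.backward y (q + (k + 1 + 1)) h (q + (k + 1) + 1) = h from
              backward_self S y (q + (k + 1) + 1) h]
          gcongr
          exact hG.mul_supG_le y (q + k + 1) w

/-! ### Total mass of the backward semigroup -/

/-- The total mass `𝔼[∏_{q ≤ i < n} G_i(X_i) | X_q = x]` of the backward semigroup. -/
abbrev Model.mass (S : Model E Obs) (y : ∀ t, Obs t) (n q : ℕ) : E q → ℝ≥0∞ :=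
  S.backward y n (fun _ => 1) q

lemma measurable_mass {n q : ℕ} (hq : q ≤ n) : Measurable (S.mass y n q) :=
  measurable_backward_right S y measurable_const hq

variable (S) in
lemma mass_bounded {n q : ℕ} (hq : q ≤ n) : ∃ C : ℝ≥0, ∀ x, S.mass y n q x ≤ C := by
  induction hq using Nat.decreasingInduction with
  | self => exact ⟨1, fun x => by simp [Model.mass, backward_self]⟩
  | of_succ k hk ih =>
    obtain ⟨C, hC⟩ := ih
    obtain ⟨D, hD⟩ := S.bounded_G k (y k)
    refine ⟨D * C, fun x => ?_⟩
    rw [Model.mass, backward_of_lt S y hk]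
    push_cast
    gcongr
    · exact hD x
    · calc _ ≤ ∫⁻ _, (C : ℝ≥0∞) ∂(S.M k x) := lintegral_mono hC
        _ = C := by simp

lemma mass_pos (hG : S.RegularG εG) {n q : ℕ} (hq : q ≤ n) (x : E q) : 0 < S.mass y n q x := by
  revert x
  induction hq using Nat.decreasingInduction with
  | self => simp [Model.mass, backward_self]
  | of_succ k hk ih =>
    intro x
    rw [Model.mass, backward_of_lt S y hk]
    refine ENNReal.mul_pos (by simpa using (hG.G_pos k (y k) x).ne') ?_
    intro h0
    rw [lintegral_eq_zero_iff (measurable_mass y hk)] at h0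
    obtain ⟨z, hz⟩ := h0.exists
    exact (ih z).ne' hz

lemma backward_le_mass {n : ℕ} {h : E n → ℝ≥0∞} (hh : ∀ x, h x ≤ 1) {q : ℕ} (hq : q ≤ n) (x : E q) :
    S.backward y n h q x ≤ S.mass y n q x := backward_mono S y hh hq x

/-- Over the first m steps, comparing the first potential at x and x' costs εG, the other m − 1
potentials cost εG^(m−1), and the law of the state at time q + m costs εM. If fewer than m steps
remain there is no mixing, but the potentials alone cost at most εG^m. -/
lemma mul_mass_le (hG : S.RegularG εG) (hM : S.RegularM m εM) {n q : ℕ} (hq : q ≤ n)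
    (x x' : E q) :
    ENNReal.ofReal εM * ENNReal.ofReal εG ^ m * S.mass y n q x' ≤ S.mass y n q x := by
  have hM1 : ENNReal.ofReal εM ≤ 1 := ENNReal.ofReal_le_one.2 hM.2.2.1.le
  have hG1 : ENNReal.ofReal εG ≤ 1 := ENNReal.ofReal_le_one.2 hG.2.1
  rcases le_or_gt (q + m) n with hmn | hmn
  · obtain ⟨j, rfl⟩ : ∃ j, m = j + 1 := ⟨m - 1, by have := hM.1; omega⟩
    have hg := measurable_mass (S := S) y hmn
    rw [Model.mass, ← backward_restart S y hmn _ (by omega)]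
    have h1 := backward_le_composite S y q j hg x'
    have h2 := composite_le_backward y hG q j hg x
    refine le_trans ?_ h2
    calc _ ≤ ENNReal.ofReal εM * ENNReal.ofReal εG ^ (j + 1) * _ := mul_le_mul_right h1 _
      _ = ENNReal.ofReal εG ^ j * ((ENNReal.ofReal εG * S.G q (y q) x') *
          (∏ i ∈ range j, S.supG y (q + i + 1)) *
          (ENNReal.ofReal εM * ∫⁻ z, S.mass y n (q + (j + 1)) z ∂(S.composite q (j + 1) x'))) := by
          ring
      _ ≤ _ := by
          gcongr
          · exact hG.ofReal_mul_le q (y q) x x'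
          · exact hM.mul_lintegral_le q x x' _
  · obtain ⟨j, rfl⟩ : ∃ j, n = q + j := ⟨n - q, by omega⟩
    rcases j with _ | j
    · rw [Model.mass, show S.backward y (q + 0) (fun _ => 1) q = fun _ => 1 from
        backward_self S y q _]
      rw [mul_one]
      exact mul_le_one' hM1 (pow_le_one' hG1 _)
    · have h1 := backward_le_composite S y q j (h := fun _ => 1) measurable_const x'
      have h2 := composite_le_backward y hG q j (h := fun _ => 1) measurable_const x
      simp only [lintegral_const, measure_univ, mul_one] at h1 h2
      refine le_trans ?_ h2
      calc _ ≤ 1 * ENNReal.ofReal εG ^ (j + 1) * _ :=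
            mul_le_mul' (mul_le_mul' hM1 (pow_le_pow_right_of_le_one' hG1 (by omega))) h1
        _ = ENNReal.ofReal εG ^ j * ((ENNReal.ofReal εG * S.G q (y q) x') *
          (∏ i ∈ range j, S.supG y (q + i + 1))) := by ring
        _ ≤ _ := by
            gcongr
            exact hG.ofReal_mul_le q (y q) x x'

end Regular
end Backward

section Contraction

variable {E : ℕ → Type*} [∀ t, MeasurableSpace (E t)]
  {Obs : ℕ → Type*} [∀ t, MeasurableSpace (Obs t)]
  {S : Model E Obs} (y : ∀ t, Obs t) {m : ℕ} {εM εG : ℝ}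

/-! ### Contraction of the normalised backward semigroup -/

/-- The minorization constant of one block of `m` steps. -/
def minorizationConst (m : ℕ) (εM εG : ℝ) : ℝ≥0 := εM.toNNReal ^ 2 * εG.toNNReal ^ (m - 1)

lemma coe_minorizationConst (h : S.RegularG εG) (h' : S.RegularM m εM) :
    (minorizationConst m εM εG : ℝ) = εM ^ 2 * εG ^ (m - 1) := by
  simp [minorizationConst, h.1.le, h'.2.1.le]

lemma minorizationConst_le_one (h : S.RegularG εG) (h' : S.RegularM m εM) :
    minorizationConst m εM εG ≤ 1 :=
  mul_le_one' (pow_le_one' (Real.toNNReal_le_one.2 h'.2.2.1.le) _)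
    (pow_le_one' (Real.toNNReal_le_one.2 h.2.1) _)

/-- Doeblin condition for the g-transformed block kernel v ↦ Q(gv)/Q(g), with w = gv and Q the
backward operator of the block: it dominates ρ times a probability independent of x, the g-weighted
law of the chain started at x₀. One factor εM moves the start from x to x₀ in the integral of w, the
other in that of g, while G_q(x) and the suprema cancel. Multiplying out avoids division in `ℝ≥0∞`.
-/
lemma backward_minorization (hG : S.RegularG εG) (hM : S.RegularM m εM) (q : ℕ)
    {g w : E (q + m) → ℝ≥0∞} (hg : Measurable g) (hw : Measurable w) (x x₀ : E q) :
    minorizationConst m εM εG * (∫⁻ z, w z ∂(S.composite q m x₀)) * S.backward y (q + m) g q x ≤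
      S.backward y (q + m) w q x * ∫⁻ z, g z ∂(S.composite q m x₀) := by
  obtain ⟨j, rfl⟩ : ∃ j, m = j + 1 := ⟨m - 1, by have := hM.1; omega⟩
  have h1 := backward_le_composite S y q j hg x
  have h2 := composite_le_backward y hG q j hw x
  have e : (minorizationConst (j + 1) εM εG : ℝ≥0∞) =
      ENNReal.ofReal εM ^ 2 * ENNReal.ofReal εG ^ j := by
    simp [minorizationConst, ENNReal.ofReal]
  rw [e]
  calc _ ≤ ENNReal.ofReal εM ^ 2 * ENNReal.ofReal εG ^ j *
        (∫⁻ z, w z ∂(S.composite q (j + 1) x₀)) * _ := mul_le_mul_right h1 _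
    _ = ENNReal.ofReal εG ^ j * (S.G q (y q) x * (∏ i ∈ range j, S.supG y (q + i + 1)) *
          (ENNReal.ofReal εM * ∫⁻ z, w z ∂(S.composite q (j + 1) x₀))) *
          (ENNReal.ofReal εM * ∫⁻ z, g z ∂(S.composite q (j + 1) x)) := by ring
    _ ≤ ENNReal.ofReal εG ^ j * (S.G q (y q) x * (∏ i ∈ range j, S.supG y (q + i + 1)) *
          (∫⁻ z, w z ∂(S.composite q (j + 1) x))) *
          (∫⁻ z, g z ∂(S.composite q (j + 1) x₀)) := by
        gcongr
        · exact hM.mul_lintegral_le q x x₀ w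
        · exact hM.mul_lintegral_le q x₀ x g
    _ ≤ _ := mul_le_mul_left h2 _

lemma nonempty_state (S : Model E Obs) (y : ∀ t, Obs t) (q : ℕ) : Nonempty (E q) :=
  (S.nonzero_G q (y q)).nonempty

/-- The minorization applied to the nonnegative functions u − ag and bg − u raises the lower bound
and lowers the upper one. The two gains add up to ρ(b − a), so the interval shrinks by the factor 1
− ρ. -/
lemma exists_ratio_bounds_block (hG : S.RegularG εG) (hM : S.RegularM m εM) (q : ℕ)
    {g u : E (q + m) → ℝ≥0∞} (hg : Measurable g) (hu : Measurable u) (hg0 : ∀ z, 0 < g z)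
    {C : ℝ≥0} (hgC : ∀ z, g z ≤ C) (hQ : ∀ x, S.backward y (q + m) g q x ≠ ∞)
    {a b : ℝ≥0} (hau : ∀ z, a * g z ≤ u z) (hub : ∀ z, u z ≤ b * g z) :
    ∃ a' b' : ℝ≥0, a' ≤ b' ∧
      (b' : ℝ) - a' = (1 - minorizationConst m εM εG) * (b - a) ∧
      ∀ x, a' * S.backward y (q + m) g q x ≤ S.backward y (q + m) u q x ∧
        S.backward y (q + m) u q x ≤ b' * S.backward y (q + m) g q x := by
  obtain ⟨x₀⟩ := nonempty_state S y q
  have hqm : q ≤ q + m := Nat.le_add_right q m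
  set ρ := minorizationConst m εM εG with hρ
  have hρ1 : ρ ≤ 1 := minorizationConst_le_one hG hM
  have hgt : ∀ z, g z ≠ ∞ := fun z => ((hgC z).trans_lt ENNReal.coe_lt_top).ne
  have hagt : ∀ z, a * g z ≠ ∞ := fun z => ENNReal.mul_ne_top ENNReal.coe_ne_top (hgt z)
  have hbgt : ∀ z, b * g z ≠ ∞ := fun z => ENNReal.mul_ne_top ENNReal.coe_ne_top (hgt z)
  set w : E (q + m) → ℝ≥0∞ := fun z => u z - a * g z with hw
  set w' : E (q + m) → ℝ≥0∞ := fun z => b * g z - u z with hw'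
  have hwm : Measurable w := by fun_prop
  have hwm' : Measurable w' := by fun_prop
  have e1 : u = w + fun z => a * g z := by
    ext z; exact (tsub_add_cancel_of_le (hau z)).symm
  have e2 : (fun z => b * g z) = w' + u := by
    ext z; exact (tsub_add_cancel_of_le (hub z)).symm
  set I := ∫⁻ z, g z ∂(S.composite q m x₀) with hI
  have hI0 : I ≠ 0 := by
    intro h0
    rw [hI, lintegral_eq_zero_iff hg] at h0
    obtain ⟨z, hz⟩ := h0.exists
    exact (hg0 z).ne' hz
  have hIt : I ≠ ∞ := by
    refine ((lintegral_mono hgC).trans_lt ?_).ne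
    simp
  set W := ∫⁻ z, w z ∂(S.composite q m x₀) with hW
  set W' := ∫⁻ z, w' z ∂(S.composite q m x₀) with hW'
  have e3 : b * I = W' + (W + a * I) := by
    rw [hI, hW, hW', ← lintegral_const_mul _ hg, ← lintegral_const_mul _ hg,
      ← lintegral_add_left hwm, ← lintegral_add_left hwm']
    refine lintegral_congr fun z => ?_
    exact (congrFun e2 z).trans (congrArg (w' z + ·) (congrFun e1 z))
  have hbI : b * I ≠ ∞ := ENNReal.mul_ne_top ENNReal.coe_ne_top hIt
  have hWt : W ≠ ∞ := ne_top_of_le_ne_top hbI (e3 ▸ le_self_add.trans le_add_self)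
  have hWt' : W' ≠ ∞ := ne_top_of_le_ne_top hbI (e3 ▸ le_self_add)
  -- θ and θ' are the distances from a and b to the mean of u/g under the g-weighted law of the
  -- chain started at x₀; hence θ + θ' = b − a.
  set θ : ℝ≥0 := (W / I).toNNReal with hθ
  set θ' : ℝ≥0 := (W' / I).toNNReal with hθ'
  have eθ : (θ : ℝ≥0∞) = W / I := ENNReal.coe_toNNReal (ENNReal.div_ne_top hWt hI0)
  have eθ' : (θ' : ℝ≥0∞) = W' / I := ENNReal.coe_toNNReal (ENNReal.div_ne_top hWt' hI0)
  have e4 : b = θ' + (θ + a) := by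
    have : (b : ℝ≥0∞) = θ' + (θ + a) := by
      rw [eθ, eθ']
      calc (b : ℝ≥0∞) = b * I / I := (ENNReal.mul_div_cancel_right hI0 hIt).symm
        _ = _ := by
          rw [e3, ENNReal.add_div, ENNReal.add_div, ENNReal.mul_div_cancel_right hI0 hIt]
    exact_mod_cast this
  have minor : ∀ (v : E (q + m) → ℝ≥0∞), Measurable v → ∀ x,
      ρ * ((∫⁻ z, v z ∂(S.composite q m x₀)) / I) * S.backward y (q + m) g q x ≤
        S.backward y (q + m) v q x := fun v hv x => by
    have := backward_minorization y hG hM q hg hv x x₀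
    calc _ = ρ * (∫⁻ z, v z ∂(S.composite q m x₀)) * S.backward y (q + m) g q x / I := by
          simp only [div_eq_mul_inv]; ring
      _ ≤ _ := ENNReal.div_le_of_le_mul this
  have hle' : ρ * θ' ≤ θ' := mul_le_of_le_one_left (zero_le) hρ1
  have hle : ρ * θ ≤ θ := mul_le_of_le_one_left (zero_le) hρ1
  have hb' : ρ * θ' ≤ b := by rw [e4]; exact hle'.trans le_self_add
  refine ⟨a + ρ * θ, b - ρ * θ', ?_, ?_, fun x => ⟨?_, ?_⟩⟩
  · rw [le_tsub_iff_right hb', e4]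
    calc a + ρ * θ + ρ * θ' ≤ a + θ + θ' := by gcongr
      _ = _ := by ring
  · rw [NNReal.coe_sub hb', e4]
    push_cast
    ring
  · rw [e1, backward_add S y hwm hqm, Pi.add_apply, backward_const_mul S y hg a hqm]
    push_cast
    rw [add_mul, add_comm, eθ]
    gcongr
    exact minor w hwm x
  · have h1 : S.backward y (q + m) w' q x + S.backward y (q + m) u q x =
        b * S.backward y (q + m) g q x := by
      rw [← backward_const_mul S y hg b hqm, e2, backward_add S y hwm' hqm, Pi.add_apply]
    have h2 := minor w' hwm' x
    rw [← hW', ← eθ'] at h2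
    have hfin : ρ * θ' * S.backward y (q + m) g q x ≠ ∞ :=
      ENNReal.mul_ne_top (by exact_mod_cast ENNReal.coe_ne_top) (hQ x)
    refine (ENNReal.add_le_add_iff_left hfin).1 ?_
    calc _ ≤ S.backward y (q + m) w' q x + S.backward y (q + m) u q x := by gcongr
      _ = _ := by
        rw [h1, ← add_mul]
        congr 1
        have : b = ρ * θ' + (b - ρ * θ') := (add_tsub_cancel_of_le hb').symm
        exact_mod_cast this

/-- Each block of m steps contracts the interval of ratios. When fewer than m steps remain before n,
only the trivial interval [0, 1] is available, whence the integer division in the exponent. -/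
lemma exists_ratio_bounds (hG : S.RegularG εG) (hM : S.RegularM m εM) {n : ℕ} {h : E n → ℝ≥0∞}
    (hh : Measurable h) (hh1 : ∀ x, h x ≤ 1) {q : ℕ} (hq : q ≤ n) :
    ∃ a b : ℝ≥0, a ≤ b ∧
      (b : ℝ) - a ≤ (1 - minorizationConst m εM εG) ^ ((n - q) / m) ∧
      ∀ x, a * S.mass y n q x ≤ S.backward y n h q x ∧
        S.backward y n h q x ≤ b * S.mass y n q x := by
  have hm := hM.1
  have hρ1 : (minorizationConst m εM εG : ℝ) ≤ 1 := by
    exact_mod_cast minorizationConst_le_one hG hM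
  induction hk : n - q using Nat.strong_induction_on generalizing q with
  | _ k ih =>
    rcases lt_or_ge k m with hkm | hkm
    · refine ⟨0, 1, zero_le_one, ?_, fun x => ⟨by simp, ?_⟩⟩
      · simp [Nat.div_eq_of_lt hkm]
      · simpa using backward_le_mass y hh1 hq x
    · have hqm : q + m ≤ n := by omega
      obtain ⟨a, b, hab, hd, hbd⟩ := ih (k - m) (by omega) hqm (by omega)
      obtain ⟨C, hC⟩ := mass_bounded S y hqm
      have hrg : S.backward y (q + m) (S.mass y n (q + m)) q = S.mass y n q :=
        backward_restart S y hqm _ (by omega)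
      obtain ⟨a', b', hab', hd', hbd'⟩ := exists_ratio_bounds_block y hG hM q
        (measurable_mass y hqm) (measurable_backward_right S y hh hqm) (mass_pos y hG hqm) hC
        (fun x => by
          obtain ⟨D, hD⟩ := mass_bounded S y hq
          rw [hrg]
          exact ((hD x).trans_lt ENNReal.coe_lt_top).ne)
        (fun z => (hbd z).1) (fun z => (hbd z).2)
      rw [hrg, backward_restart S y hqm h (by omega)] at hbd'
      refine ⟨a', b', hab', ?_, hbd'⟩
      have e : k / m = (k - m) / m + 1 := by
        rw [← Nat.add_div_right _ (by omega), Nat.sub_add_cancel hkm]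
      rw [hd', e, pow_succ, mul_comm]
      exact mul_le_mul_of_nonneg_right hd (by linarith)

end Contraction

/-! ### The Feynman-Kac flow in terms of backward functions -/

section ChainLaw

variable {E : ℕ → Type*} [∀ t, MeasurableSpace (E t)]
  {Obs : ℕ → Type*} [∀ t, MeasurableSpace (Obs t)] (S : Model E Obs) (y : ∀ t, Obs t)

/-- The transition from time `t` to time `t + 1`, as a kernel from the history up to time `t`. -/
abbrev Model.histKernel (t : ℕ) : Kernel (∀ s : Iic t, E s) (E (t + 1)) :=
  (S.M t).comap (fun x : (∀ s : Iic t, E s) => x ⟨t, by simp⟩) (measurable_pi_apply _)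

lemma chainLaw_eq_trajMeasure : S.chainLaw = Kernel.trajMeasure S.init S.histKernel := rfl

lemma map_chainLaw_zero : S.chainLaw.map (fun x => x 0) = S.init := by
  obtain ⟨φ, hφ, hφ0, h1⟩ : ∃ φ : E 0 → (∀ s : Iic 0, E s), Measurable φ ∧
      (∀ x, φ x ⟨0, by simp⟩ = x) ∧
      S.chainLaw.map (Preorder.frestrictLe 0) = S.init.map φ := by
    refine ⟨(MeasurableEquiv.piUnique (fun s : Iic 0 => E s)).symm,
      MeasurableEquiv.measurable _, fun x => rfl, ?_⟩
    rw [chainLaw_eq_trajMeasure, Kernel.trajMeasure, Measure.map_comp _ _ (by fun_prop),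
      Kernel.traj_map_frestrictLe, Kernel.partialTraj_self, Measure.id_comp]
    rfl
  have h2 : (fun x : ∀ t, E t => x 0) =
      (fun z : ∀ s : Iic 0, E s => z ⟨0, by simp⟩) ∘ Preorder.frestrictLe 0 := rfl
  rw [h2, ← Measure.map_map (measurable_pi_apply _) (by fun_prop), h1,
    Measure.map_map (measurable_pi_apply _) hφ]
  have h3 : (fun z : ∀ s : Iic 0, E s => z ⟨0, by simp⟩) ∘ φ = id := funext hφ0
  exact (congrArg (fun g => S.init.map g) h3).trans Measure.map_id

lemma lintegral_gamma (t : ℕ) {f : E t → ℝ≥0∞} (hf : Measurable f) :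
    ∫⁻ x, f x ∂(S.gamma y t) =
      ∫⁻ x, (∏ i ∈ range t, (S.G i (y i) (x i) : ℝ≥0∞)) * f (x t) ∂S.chainLaw := by
  have hGm : ∀ i, Measurable fun x : ∀ t, E t => S.G i (y i) (x i) := fun i =>
    ((S.measurable_G i).comp measurable_prodMk_left).comp (measurable_pi_apply i)
  have hft : Measurable fun x : ∀ t, E t => f (x t) := hf.comp (measurable_pi_apply t)
  rw [Model.gamma, lintegral_map hf (measurable_pi_apply t),
    lintegral_withDensity_eq_lintegral_mul _ _ hft]
  · simp
  · exact (Finset.measurable_fun_prod _ fun i _ => hGm i).coe_nnreal_ennreal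

lemma gamma_zero : S.gamma y 0 = S.init := by
  simp [Model.gamma, map_chainLaw_zero]

/-- Markov property of the path law: the weights up to time t depend on the history only, so they
leave the integral over X_{t+1}. -/
lemma lintegral_gamma_succ (t : ℕ) {f : E (t + 1) → ℝ≥0∞} (hf : Measurable f) :
    ∫⁻ x, f x ∂(S.gamma y (t + 1)) =
      ∫⁻ x, S.G t (y t) x * ∫⁻ z, f z ∂(S.M t x) ∂(S.gamma y t) := by
  have hGm : ∀ i, Measurable fun x : E i => S.G i (y i) x := fun i =>
    (S.measurable_G i).comp measurable_prodMk_left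
  have hMf : Measurable fun x => ∫⁻ z, f z ∂(S.M t x) := Measurable.lintegral_kernel hf
  have hprod : Measurable fun z : ∀ s : Iic t, E s =>
      ∏ i : Iic t, (S.G i (y i) (z i) : ℝ≥0∞) :=
    Finset.measurable_fun_prod _ fun i _ =>
      ((hGm i).comp (measurable_pi_apply i)).coe_nnreal_ennreal
  have key := Kernel.map_frestrictLe_trajMeasure_compProd_eq_map_trajMeasure
    (μ₀ := S.init) (κ := S.histKernel) (a := t)
  have e : ∀ x : ∀ t, E t, ∏ i ∈ range (t + 1), (S.G i (y i) (x i) : ℝ≥0∞) =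
      ∏ i : Iic t, (S.G i (y i) (Preorder.frestrictLe t x i) : ℝ≥0∞) := fun x => by
    rw [Nat.range_succ_eq_Iic]
    exact (Finset.prod_coe_sort (Iic t) fun i => (S.G i (y i) (x i) : ℝ≥0∞)).symm
  have hGMf : Measurable fun x => (S.G t (y t) x : ℝ≥0∞) * ∫⁻ z, f z ∂(S.M t x) :=
    (hGm t).coe_nnreal_ennreal.mul hMf
  have hF : Measurable fun w : (∀ s : Iic t, E s) × E (t + 1) =>
      (∏ i : Iic t, (S.G i (y i) (w.1 i) : ℝ≥0∞)) * f w.2 :=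
    (hprod.comp measurable_fst).mul (hf.comp measurable_snd)
  have hF' : Measurable fun z : ∀ s : Iic t, E s =>
      (∏ i : Iic t, (S.G i (y i) (z i) : ℝ≥0∞)) * ∫⁻ x', f x' ∂(S.M t (z ⟨t, by simp⟩)) :=
    hprod.mul (hMf.comp (measurable_pi_apply _))
  rw [lintegral_gamma S y _ hf, lintegral_gamma S y _ hGMf]
  calc _ = ∫⁻ w, (∏ i : Iic t, (S.G i (y i) (w.1 i) : ℝ≥0∞)) * f w.2
        ∂(S.chainLaw.map fun x => (Preorder.frestrictLe t x, x (t + 1))) := by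
        rw [lintegral_map hF (by fun_prop)]
        simp only [e]
    _ = ∫⁻ z, ∫⁻ x', (∏ i : Iic t, (S.G i (y i) (z i) : ℝ≥0∞)) * f x' ∂(S.histKernel t z)
          ∂(S.chainLaw.map (Preorder.frestrictLe t)) := by
        rw [chainLaw_eq_trajMeasure, ← key, Measure.lintegral_compProd hF]
    _ = ∫⁻ z, (∏ i : Iic t, (S.G i (y i) (z i) : ℝ≥0∞)) *
          ∫⁻ x', f x' ∂(S.M t (z ⟨t, by simp⟩)) ∂(S.chainLaw.map (Preorder.frestrictLe t)) := by
        refine lintegral_congr fun z => ?_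
        rw [lintegral_const_mul _ hf]
        rfl
    _ = _ := by
        rw [lintegral_map hF' (by fun_prop)]
        refine lintegral_congr fun x => ?_
        rw [← e, prod_range_succ, mul_assoc]
        rfl

/-- The integral of the backward function at time q against γ_q does not depend on q ≤ n. -/
lemma lintegral_gamma_eq_init {n : ℕ} {h : E n → ℝ≥0∞} (hh : Measurable h) :
    ∫⁻ x, h x ∂(S.gamma y n) = ∫⁻ x, S.backward y n h 0 x ∂S.init := by
  have key : ∀ q, q ≤ n → ∫⁻ x, S.backward y n h q x ∂(S.gamma y q) =
      ∫⁻ x, S.backward y n h 0 x ∂S.init := by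
    intro q
    induction q with
    | zero => intro _; rw [gamma_zero]
    | succ q ih =>
      intro hq
      rw [← ih (by omega), lintegral_gamma_succ S y q (measurable_backward_right S y hh hq)]
      refine lintegral_congr fun x => ?_
      rw [backward_of_lt S y (by omega)]
  rw [← key n le_rfl, backward_self]

end ChainLaw

/-! ### Normalised backward functionals -/

section Ratio

variable {E : ℕ → Type*} [∀ t, MeasurableSpace (E t)]
  {Obs : ℕ → Type*} [∀ t, MeasurableSpace (Obs t)]

/-- The value `Φ_{q,n}(ν)(h)` of the Feynman-Kac semigroup. -/
def Model.ratio (S : Model E Obs) (y : ∀ t, Obs t) (n : ℕ) (h : E n → ℝ≥0∞) (q : ℕ)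
    (ν : Measure (E q)) : ℝ :=
  ((∫⁻ x, S.backward y n h q x ∂ν) / ∫⁻ x, S.mass y n q x ∂ν).toReal

variable {S : Model E Obs} (y : ∀ t, Obs t) {m : ℕ} {εM εG : ℝ} {n : ℕ} {h : E n → ℝ≥0∞}

lemma ratio_self (S : Model E Obs) (h : E n → ℝ≥0∞) (ν : Measure (E n)) [IsProbabilityMeasure ν] :
    S.ratio y n h n ν = (∫⁻ x, h x ∂ν).toReal := by
  simp [Model.ratio, Model.mass, backward_self]

lemma lintegral_potential_ne (hG : S.RegularG εG) (q : ℕ) (ν : Measure (E q))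
    [IsProbabilityMeasure ν] :
    ∫⁻ x, S.G q (y q) x ∂ν ≠ 0 ∧ ∫⁻ x, S.G q (y q) x ∂ν ≠ ∞ := by
  have hGm : Measurable fun x : E q => S.G q (y q) x :=
    (S.measurable_G q).comp measurable_prodMk_left
  constructor
  · intro h0
    rw [lintegral_eq_zero_iff hGm.coe_nnreal_ennreal] at h0
    obtain ⟨z, hz⟩ := h0.exists
    exact (hG.G_pos q (y q) z).ne' (by simpa using hz)
  · refine ((lintegral_mono (le_supG S y q)).trans_lt ?_).ne
    simpa using supG_lt_top S y q

lemma isProbabilityMeasure_update (hG : S.RegularG εG) (q : ℕ) (ν : Measure (E q))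
    [IsProbabilityMeasure ν] : IsProbabilityMeasure (update (S.G q (y q)) (S.M q) ν) := by
  obtain ⟨h0, ht⟩ := lintegral_potential_ne y hG q ν
  have hGm : Measurable (S.G q (y q)) := (S.measurable_G q).comp measurable_prodMk_left
  constructor
  rw [update_apply _ hGm _ _ MeasurableSet.univ]
  simp only [measure_univ, mul_one]
  exact ENNReal.inv_mul_cancel h0 ht

lemma lintegral_update {F F' : Type*} [MeasurableSpace F] [MeasurableSpace F'] {g : F → ℝ≥0}
    (hg : Measurable g) (K : Kernel F F') (ν : Measure F) {f : F' → ℝ≥0∞} (hf : Measurable f) :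
    ∫⁻ z, f z ∂(update g K ν) = (∫⁻ x, g x ∂ν)⁻¹ * ∫⁻ x, g x * ∫⁻ z, f z ∂(K x) ∂ν := by
  have hk : Measurable fun x => ∫⁻ z, f z ∂(K x) := Measurable.lintegral_kernel hf
  rw [update, Measure.lintegral_bind K.aemeasurable hf.aemeasurable, boltzmannGibbs,
    lintegral_smul_measure, lintegral_withDensity_eq_lintegral_mul _ (by fun_prop) hk]
  rfl

/-- The normalisation ν(G_q) cancels between numerator and denominator. This turns a telescoping
increment into a pure sampling error around `update`. -/
lemma ratio_update (hG : S.RegularG εG) (hh : Measurable h) {q : ℕ} (hq : q < n)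
    (ν : Measure (E q)) [IsProbabilityMeasure ν] :
    S.ratio y n h (q + 1) (update (S.G q (y q)) (S.M q) ν) = S.ratio y n h q ν := by
  obtain ⟨h0, ht⟩ := lintegral_potential_ne y hG q ν
  have hGm : Measurable (S.G q (y q)) := (S.measurable_G q).comp measurable_prodMk_left
  have key : ∀ f : E n → ℝ≥0∞, Measurable f →
      ∫⁻ z, S.backward y n f (q + 1) z ∂(update (S.G q (y q)) (S.M q) ν) =
        (∫⁻ x, S.G q (y q) x ∂ν)⁻¹ * ∫⁻ x, S.backward y n f q x ∂ν := fun f hf => by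
    rw [lintegral_update hGm _ _ (measurable_backward_right S y hf hq)]
    congr 1
    exact lintegral_congr fun x => (backward_of_lt S y hq f x).symm
  rw [Model.ratio, Model.mass, key h hh, key _ measurable_const, Model.ratio,
    ENNReal.mul_div_mul_left _ _ (ENNReal.inv_ne_zero.2 ht) (ENNReal.inv_ne_top.2 h0)]

lemma lintegral_mass_ne (hG : S.RegularG εG) {q : ℕ} (hq : q ≤ n) (ν : Measure (E q))
    [IsProbabilityMeasure ν] :
    ∫⁻ x, S.mass y n q x ∂ν ≠ 0 ∧ ∫⁻ x, S.mass y n q x ∂ν ≠ ∞ := by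
  obtain ⟨C, hC⟩ := mass_bounded S y hq
  constructor
  · intro h0
    rw [lintegral_eq_zero_iff (measurable_mass y hq)] at h0
    obtain ⟨z, hz⟩ := h0.exists
    exact (mass_pos y hG hq z).ne' hz
  · refine ((lintegral_mono hC).trans_lt ?_).ne
    simp

lemma gamma_univ (S : Model E Obs) (n : ℕ) :
    S.gamma y n Set.univ = ∫⁻ x, S.mass y n 0 x ∂S.init := by
  rw [← lintegral_gamma_eq_init S y measurable_const, lintegral_one]

lemma isProbabilityMeasure_eta (hG : S.RegularG εG) (n : ℕ) :
    IsProbabilityMeasure (S.eta y n) := by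
  obtain ⟨h0, ht⟩ := lintegral_mass_ne y hG (Nat.zero_le n) S.init
  constructor
  rw [Model.eta, Measure.smul_apply, smul_eq_mul, gamma_univ]
  exact ENNReal.inv_mul_cancel h0 ht

lemma ratio_zero_init (S : Model E Obs) (hh : Measurable h) :
    S.ratio y n h 0 S.init = (∫⁻ x, h x ∂(S.eta y n)).toReal := by
  rw [Model.ratio, Model.eta, lintegral_smul_measure, smul_eq_mul, gamma_univ,
    lintegral_gamma_eq_init S y hh, ENNReal.div_eq_inv_mul]

lemma measurable_ratio_empirical (S : Model E Obs) (hh : Measurable h) {q : ℕ} (hq : q ≤ n)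
    (N : ℕ) :
    Measurable fun z : (∀ t, Obs t) × (Fin N → E q) => S.ratio z.1 n h q (empirical z.2) := by
  have key : ∀ f : E n → ℝ≥0∞, Measurable f →
      Measurable fun z : (∀ t, Obs t) × (Fin N → E q) =>
        ∫⁻ x, S.backward z.1 n f q x ∂(empirical z.2) := fun f hf => by
    simp only [lintegral_empirical _ (measurable_backward_right S _ hf hq)]
    refine Measurable.const_mul (Finset.measurable_fun_sum _ fun k _ => ?_) _
    exact (measurable_backward S hf hq).comp
      (measurable_fst.prodMk ((measurable_pi_apply k).comp measurable_snd))
  exact ((key h hh).div (key _ measurable_const)).ennreal_toReal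

lemma measurable_ratio_init (S : Model E Obs) (hh : Measurable h) :
    Measurable fun y : ∀ t, Obs t => S.ratio y n h 0 S.init := by
  have key : ∀ f : E n → ℝ≥0∞, Measurable f →
      Measurable fun y : ∀ t, Obs t => ∫⁻ x, S.backward y n f 0 x ∂S.init := fun f hf =>
    (measurable_backward S hf (Nat.zero_le n)).lintegral_prod_right'
  exact ((key h hh).div (key _ measurable_const)).ennreal_toReal

/-- The bound on the relative oscillation of the total mass. -/
def massRatio (m : ℕ) (εM εG : ℝ) : ℝ := (εM * εG ^ m)⁻¹

/-- Since Φ(ν)(h) − c = ν(u − cg)/ν(g), the nonlinear difference becomes linear in ν up to the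
bounded factor D/ν(g). The function f depends on μ but not on ν, so the random empirical measure may
be substituted for ν. -/
lemma ratio_sub_ratio_le (hG : S.RegularG εG) (hM : S.RegularM m εM) (hh : Measurable h)
    (hh1 : ∀ x, h x ≤ 1) {q : ℕ} (hq : q ≤ n) (μ : Measure (E q)) [IsProbabilityMeasure μ] :
    ∃ (f : E q → ℝ) (a b : ℝ), Measurable f ∧ (∀ x, f x ∈ Set.Icc a b) ∧ a ≤ b ∧
      b - a ≤ (1 - minorizationConst m εM εG) ^ ((n - q) / m) ∧ ∫ x, f x ∂μ = 0 ∧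
      ∀ (ν : Measure (E q)) [IsProbabilityMeasure ν],
        |S.ratio y n h q ν - S.ratio y n h q μ| ≤ massRatio m εM εG * |∫ x, f x ∂ν| := by
  obtain ⟨a, b, hab, hd, hbd⟩ := exists_ratio_bounds y hG hM hh hh1 hq
  obtain ⟨C, hC⟩ := mass_bounded S y hq
  obtain ⟨x₀⟩ := nonempty_state S y q
  have hgm := measurable_mass (S := S) y hq
  have hum := measurable_backward_right S y hh hq
  have hgt : ∀ x, S.mass y n q x ≠ ∞ := fun x => ((hC x).trans_lt ENNReal.coe_lt_top).ne
  have hut : ∀ x, S.backward y n h q x ≠ ∞ := fun x =>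
    ne_top_of_le_ne_top (hgt x) (backward_le_mass y hh1 hq x)
  set g : E q → ℝ := fun x => (S.mass y n q x).toReal with hg
  set u : E q → ℝ := fun x => (S.backward y n h q x).toReal with hu
  have hgm' : Measurable g := hgm.ennreal_toReal
  have hum' : Measurable u := hum.ennreal_toReal
  have hg0 : ∀ x, 0 < g x := fun x => ENNReal.toReal_pos (mass_pos y hG hq x).ne' (hgt x)
  have hu0 : ∀ x, 0 ≤ u x := fun x => ENNReal.toReal_nonneg
  have hua : ∀ x, a * g x ≤ u x := fun x => by
    have := ENNReal.toReal_mono (hut x) (hbd x).1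
    rwa [ENNReal.toReal_mul, ENNReal.coe_toReal] at this
  have hub : ∀ x, u x ≤ b * g x := fun x => by
    have := ENNReal.toReal_mono (ENNReal.mul_ne_top ENNReal.coe_ne_top (hgt x)) (hbd x).2
    rwa [ENNReal.toReal_mul, ENNReal.coe_toReal] at this
  set G := ⨆ x, S.mass y n q x with hGdef
  have hGt : G ≠ ∞ := ((iSup_le hC).trans_lt ENNReal.coe_lt_top).ne
  set D := G.toReal with hD
  have hgD : ∀ x, g x ≤ D := fun x => ENNReal.toReal_mono hGt (le_iSup (S.mass y n q) x)
  have hD0 : 0 < D := (hg0 x₀).trans_le (hgD x₀)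
  have hεM := hM.2.1
  have hεG := hG.1
  have hDg : ∀ x, εM * εG ^ m * D ≤ g x := fun x => by
    have h1 : ENNReal.ofReal εM * ENNReal.ofReal εG ^ m * G ≤ S.mass y n q x := by
      rw [hGdef, ENNReal.mul_iSup]
      exact iSup_le fun x' => mul_mass_le y hG hM hq x x'
    have := ENNReal.toReal_mono (hgt x) h1
    rwa [ENNReal.toReal_mul, ENNReal.toReal_mul, ENNReal.toReal_pow,
      ENNReal.toReal_ofReal hεM.le, ENNReal.toReal_ofReal hεG.le] at this
  have hgi : ∀ (ν : Measure (E q)) [IsProbabilityMeasure ν], Integrable g ν := fun ν _ =>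
    Integrable.of_mem_Icc 0 D hgm'.aemeasurable (ae_of_all _ fun x => ⟨(hg0 x).le, hgD x⟩)
  have hui : ∀ (ν : Measure (E q)) [IsProbabilityMeasure ν], Integrable u ν := fun ν _ =>
    Integrable.of_mem_Icc 0 (b * D) hum'.aemeasurable (ae_of_all _ fun x =>
      ⟨hu0 x, (hub x).trans (mul_le_mul_of_nonneg_left (hgD x) b.2)⟩)
  have hνg : ∀ (ν : Measure (E q)) [IsProbabilityMeasure ν], εM * εG ^ m * D ≤ ∫ x, g x ∂ν :=
    fun ν _ => by simpa using integral_mono (integrable_const _) (hgi ν) hDg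
  have hεD : 0 < εM * εG ^ m * D := by positivity
  have hratio : ∀ (ν : Measure (E q)) [IsProbabilityMeasure ν],
      S.ratio y n h q ν = (∫ x, u x ∂ν) / ∫ x, g x ∂ν := fun ν _ => by
    rw [Model.ratio, ENNReal.toReal_div,
      integral_toReal hum.aemeasurable (ae_of_all _ fun x => (hut x).lt_top),
      integral_toReal hgm.aemeasurable (ae_of_all _ fun x => (hgt x).lt_top)]
  set c := S.ratio y n h q μ with hc
  have hμg : 0 < ∫ x, g x ∂μ := hεD.trans_le (hνg μ)
  have hcμ : c * ∫ x, g x ∂μ = ∫ x, u x ∂μ := by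
    rw [hc, hratio μ, div_mul_cancel₀ _ hμg.ne']
  have hac : a ≤ c := by
    refine le_of_mul_le_mul_right ?_ hμg
    rw [hcμ, ← integral_const_mul]
    exact integral_mono ((hgi μ).const_mul _) (hui μ) hua
  have hcb : c ≤ b := by
    refine le_of_mul_le_mul_right ?_ hμg
    rw [hcμ, ← integral_const_mul]
    exact integral_mono (hui μ) ((hgi μ).const_mul _) hub
  have hint : ∀ (ν : Measure (E q)) [IsProbabilityMeasure ν],
      ∫ x, (u x - c * g x) / D ∂ν = (∫ x, u x ∂ν - c * ∫ x, g x ∂ν) / D := fun ν _ => by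
    rw [integral_div, integral_sub (hui ν) ((hgi ν).const_mul c), integral_const_mul]
  -- Subtracting cg centres f under μ. The bounds on f follow from ag ≤ u ≤ bg, a ≤ c ≤ b and 0 < g
  -- ≤ D.
  refine ⟨fun x => (u x - c * g x) / D, a - c, b - c, by fun_prop, fun x => ⟨?_, ?_⟩,
    by linarith [NNReal.coe_le_coe.2 hab], by linarith, ?_, fun ν _ => ?_⟩
  · rw [le_div_iff₀ hD0]
    nlinarith [hua x, hgD x]
  · rw [div_le_iff₀ hD0]
    nlinarith [hub x, hgD x]
  · rw [hint μ, hcμ, sub_self, zero_div]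
  · have hν := hνg ν
    have hν0 : 0 < ∫ x, g x ∂ν := hεD.trans_le hν
    rw [hint ν, hratio ν]
    have e : (∫ x, u x ∂ν) / (∫ x, g x ∂ν) - c =
        D / (∫ x, g x ∂ν) * ((∫ x, u x ∂ν - c * ∫ x, g x ∂ν) / D) := by
      field_simp
    rw [e, abs_mul, abs_of_pos (div_pos hD0 hν0)]
    refine mul_le_mul_of_nonneg_right ?_ (abs_nonneg _)
    rw [massRatio, div_le_iff₀ hν0, inv_mul_eq_div, le_div_iff₀ (by positivity)]
    linarith

lemma massRatio_pos (hG : S.RegularG εG) (hM : S.RegularM m εM) : 0 < massRatio m εM εG := by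
  have := hG.1
  have := hM.2.1
  unfold massRatio
  positivity

/-- The sampling law enters only through `hκ`, so full sampling and both kinds of subsampling are
treated together; they differ in `v` alone. -/
lemma lintegral_ratio_sub_rpow_le (hG : S.RegularG εG) (hM : S.RegularM m εM) (hh : Measurable h)
    (hh1 : ∀ x, h x ≤ 1) {q : ℕ} (hq : q ≤ n) (μ : Measure (E q)) [IsProbabilityMeasure μ]
    {N : ℕ} [NeZero N] (κ : Measure (Fin N → E q)) [IsProbabilityMeasure κ] {v : ℝ≥0}
    (hκ : ∀ (f : E q → ℝ) (a b : ℝ), Measurable f → (∀ x, f x ∈ Set.Icc a b) →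
      HasSubgaussianMGF (fun x => empiricalMean f x - ∫ z, f z ∂μ) (hoeffdingParam a b * v) κ)
    {p : ℝ} (hp : 1 ≤ p) :
    ∫⁻ x, ENNReal.ofReal (|S.ratio y n h q (empirical x) - S.ratio y n h q μ| ^ p) ∂κ ≤
      ENNReal.ofReal ((massRatio m εM εG *
        (1 - minorizationConst m εM εG) ^ ((n - q) / m)) ^ p *
          (subgaussianConst p * ((v : ℝ) / 4) ^ (p / 2))) := by
  obtain ⟨f, a, b, hf, hfab, hab, hd, hf0, hfν⟩ := ratio_sub_ratio_le y hG hM hh hh1 hq μ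
  have hr := massRatio_pos hG hM
  have hp0 : 0 ≤ p := by linarith
  have h1 := hκ f a b hf hfab
  simp only [hf0, sub_zero] at h1
  have h2 := lintegral_empiricalMean_rpow_le hab h1 hp
  have hK := subgaussianConst_nonneg hp
  have hm := measurable_empiricalMean (N := N) hf
  calc _ ≤ ∫⁻ x, ENNReal.ofReal (massRatio m εM εG ^ p) *
        ENNReal.ofReal (|empiricalMean f x| ^ p) ∂κ := by
        refine lintegral_mono fun x => ?_
        rw [← ENNReal.ofReal_mul (by positivity), ← Real.mul_rpow hr.le (abs_nonneg _),
          ← integral_empirical x hf]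
        exact ENNReal.ofReal_le_ofReal
          (Real.rpow_le_rpow (abs_nonneg _) (hfν (empirical x)) hp0)
    _ = ENNReal.ofReal (massRatio m εM εG ^ p) *
          ∫⁻ x, ENNReal.ofReal (|empiricalMean f x| ^ p) ∂κ := by
        refine lintegral_const_mul _ ?_
        fun_prop
    _ ≤ _ := mul_le_mul_right h2 _
    _ ≤ _ := by
        rw [← ENNReal.ofReal_mul (by positivity)]
        refine ENNReal.ofReal_le_ofReal ?_
        have hb : 0 ≤ b - a := by linarith
        rw [← mul_assoc, ← Real.mul_rpow hr.le hb]
        gcongr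

end Ratio

/-! ### The local errors of the particle filter -/

section LocalErrors

variable {E : ℕ → Type*} [∀ t, MeasurableSpace (E t)]
  {Obs : ℕ → Type*} [∀ t, MeasurableSpace (Obs t)]
  {S : Model E Obs} {m : ℕ} {εM εG : ℝ} {n : ℕ} {h : E n → ℝ≥0∞} {χ Nb : ℕ}
  {Ω : Type*} [MeasurableSpace Ω] {P : Measure Ω}
  {Y : ∀ t, Ω → Obs t} {ξ : ∀ t, Ω → Fin (χ * Nb) → E t}

/-- The error made at time `q`, transported to time `n`. -/
def localError {Ω : Type*} (S : Model E Obs) (n : ℕ) (h : E n → ℝ≥0∞) {N : ℕ}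
    (Y : ∀ t, Ω → Obs t) (ξ : ∀ t, Ω → Fin N → E t) : ℕ → Ω → ℝ
  | 0, ω => S.ratio (fun t => Y t ω) n h 0 (empirical (ξ 0 ω)) -
      S.ratio (fun t => Y t ω) n h 0 S.init
  | q + 1, ω => S.ratio (fun t => Y t ω) n h (q + 1) (empirical (ξ (q + 1) ω)) -
      S.ratio (fun t => Y t ω) n h q (empirical (ξ q ω))

lemma sum_localError {Ω : Type*} {Y : ∀ t, Ω → Obs t} {ξ : ∀ t, Ω → Fin (χ * Nb) → E t}
    (ω : Ω) (k : ℕ) :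
    ∑ q ∈ range (k + 1), localError S n h Y ξ q ω =
      S.ratio (fun t => Y t ω) n h k (empirical (ξ k ω)) -
        S.ratio (fun t => Y t ω) n h 0 S.init := by
  induction k with
  | zero => simp [localError]
  | succ k ih => rw [sum_range_succ, ih, localError]; ring

lemma measurable_localError (hY : ∀ t, Measurable (Y t)) (hξ : ∀ t, Measurable (ξ t))
    (hh : Measurable h) {q : ℕ} (hq : q ≤ n) : Measurable (localError S n h Y ξ q) := by
  have hYm : Measurable fun ω t => Y t ω := measurable_pi_lambda _ hY
  have key : ∀ q ≤ n, Measurable fun ω =>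
      S.ratio (fun t => Y t ω) n h q (empirical (ξ q ω)) := fun q hq =>
    Measurable.comp (g := fun z : (∀ t, Obs t) × (Fin (χ * Nb) → E q) =>
      S.ratio z.1 n h q (empirical z.2)) (f := fun ω => ((fun t => Y t ω), ξ q ω))
      (measurable_ratio_empirical S hh hq (χ * Nb)) (hYm.prodMk (hξ q))
  cases q with
  | zero =>
    have h0 : Measurable fun ω => S.ratio (fun t => Y t ω) n h 0 S.init :=
      Measurable.comp (g := fun y : ∀ t, Obs t => S.ratio y n h 0 S.init)
        (f := fun ω t => Y t ω) (measurable_ratio_init S hh) hYm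
    exact (key 0 hq).sub h0
  | succ q => exact (key (q + 1) hq).sub (key q (by omega))

/-- The bound on the `p`-th moment of the local error at time `q` when the sub-Gaussian parameter
of the sampling error is multiplied by `v`. -/
def localBound (m : ℕ) (εM εG : ℝ) (k : ℕ) (p v : ℝ) : ℝ :=
  (massRatio m εM εG * (1 - minorizationConst m εM εG) ^ (k / m)) ^ p *
    (subgaussianConst p * (v / 4) ^ (p / 2))

lemma localFactor_nonneg (hG : S.RegularG εG) (hM : S.RegularM m εM) (k : ℕ) :
    0 ≤ massRatio m εM εG * (1 - minorizationConst m εM εG : ℝ) ^ (k / m) := by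
  have hρ1 : (minorizationConst m εM εG : ℝ) ≤ 1 := by
    exact_mod_cast minorizationConst_le_one hG hM
  exact mul_nonneg (massRatio_pos hG hM).le (pow_nonneg (by linarith) _)

lemma lintegral_stepLaw_le [NeZero χ] [NeZero Nb] (hG : S.RegularG εG) (hM : S.RegularM m εM)
    (D : DecisionRule E Obs (χ * Nb)) (mode : Upsampling) (hh : Measurable h)
    (hh1 : ∀ x, h x ≤ 1) {q : ℕ} (hq : q + 1 ≤ n) (y : ∀ t, Obs t) (x : Fin (χ * Nb) → E q)
    {p : ℝ} (hp : 1 ≤ p) :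
    ∫⁻ x', ENNReal.ofReal (|S.ratio y n h (q + 1) (empirical x') -
        S.ratio y n h q (empirical x)| ^ p) ∂(stepLaw S D mode q y x) ≤
      if D.decision q x (y (q + 1)) = true then
        ENNReal.ofReal (localBound m εM εG (n - (q + 1)) p ((1 + χ) / (χ * Nb : ℕ)))
      else ENNReal.ofReal (localBound m εM εG (n - (q + 1)) p (1 / (χ * Nb : ℕ))) := by
  have := isProbabilityMeasure_update y hG q (empirical x)
  rw [← ratio_update y hG hh hq]
  unfold stepLaw
  split_ifs
  · exact lintegral_ratio_sub_rpow_le (v := (1 + χ) / (χ * Nb : ℕ)) y hG hM hh hh1 hq _ _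
      (fun f a b hf hab => hasSubgaussianMGF_subsample χ Nb mode _ hf hab) hp
  · refine lintegral_ratio_sub_rpow_le (v := 1 / (χ * Nb : ℕ)) y hG hM hh hh1 hq _ _
      (fun f a b hf hab => ?_) hp
    rw [mul_one_div]
    exact hasSubgaussianMGF_iidSample (χ * Nb) _ hf hab

lemma lintegral_localError_zero_le [NeZero χ] [NeZero Nb] [IsProbabilityMeasure P]
    (hG : S.RegularG εG) (hM : S.RegularM m εM) {D : DecisionRule E Obs (χ * Nb)}
    {mode : Upsampling} (hξ : IsFilter P S D mode Y ξ) (hh : Measurable h) (hh1 : ∀ x, h x ≤ 1)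
    {p : ℝ} (hp : 1 ≤ p) :
    ∫⁻ ω, ENNReal.ofReal (|localError S n h Y ξ 0 ω| ^ p) ∂P ≤
      ENNReal.ofReal (localBound m εM εG n p (1 / (χ * Nb : ℕ))) := by
  have hYm : Measurable fun ω t => Y t ω := measurable_pi_lambda _ hξ.measurable_obs
  have hPY : IsProbabilityMeasure (P.map fun ω t => Y t ω) :=
    Measure.isProbabilityMeasure_map hYm.aemeasurable
  have hR : Measurable fun z : (∀ t, Obs t) × (Fin (χ * Nb) → E 0) =>
      ENNReal.ofReal (|S.ratio z.1 n h 0 (empirical z.2) - S.ratio z.1 n h 0 S.init| ^ p) := by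
    have h1 := measurable_ratio_empirical S hh (Nat.zero_le n) (χ * Nb)
    have h2 : Measurable fun z : (∀ t, Obs t) × (Fin (χ * Nb) → E 0) =>
        S.ratio z.1 n h 0 S.init := (measurable_ratio_init S hh).comp measurable_fst
    exact ((continuous_abs.measurable.comp (h1.sub h2)).pow_const p).ennreal_ofReal
  calc _ = ∫⁻ z, ENNReal.ofReal (|S.ratio z.1 n h 0 (empirical z.2) -
          S.ratio z.1 n h 0 S.init| ^ p) ∂(P.map fun ω => ((fun t => Y t ω), ξ 0 ω)) := by
        rw [lintegral_map hR (hYm.prodMk (hξ.measurable_particles 0))]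
        rfl
    _ ≤ ∫⁻ _, ENNReal.ofReal (localBound m εM εG n p (1 / (χ * Nb : ℕ)))
          ∂(P.map fun ω t => Y t ω) := by
        rw [hξ.law_zero, lintegral_prod _ hR.aemeasurable]
        refine lintegral_mono fun y => ?_
        refine lintegral_ratio_sub_rpow_le (v := 1 / (χ * Nb : ℕ)) y hG hM hh hh1
          (Nat.zero_le n) _ _ (fun f a b hf hab => ?_) hp
        rw [mul_one_div]
        exact hasSubgaussianMGF_iidSample (χ * Nb) _ hf hab
    _ = _ := by simp

/-- The decision is a function of the conditioning variables, so the conditional moment bound may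
depend on it and is averaged only afterwards. -/
lemma lintegral_localError_succ_le [NeZero χ] [NeZero Nb] [IsProbabilityMeasure P]
    (hG : S.RegularG εG) (hM : S.RegularM m εM) {D : DecisionRule E Obs (χ * Nb)}
    {mode : Upsampling} (hξ : IsFilter P S D mode Y ξ) (hh : Measurable h) (hh1 : ∀ x, h x ≤ 1)
    {q : ℕ} (hq : q + 1 ≤ n) {p : ℝ} (hp : 1 ≤ p) :
    ∫⁻ ω, ENNReal.ofReal (|localError S n h Y ξ (q + 1) ω| ^ p) ∂P ≤
      ∫⁻ ω, (if subsampled D Y ξ (q + 1) ω = true then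
        ENNReal.ofReal (localBound m εM εG (n - (q + 1)) p ((1 + χ) / (χ * Nb : ℕ)))
      else ENNReal.ofReal (localBound m εM εG (n - (q + 1)) p (1 / (χ * Nb : ℕ)))) ∂P := by
  have hYm : Measurable fun ω t => Y t ω := measurable_pi_lambda _ hξ.measurable_obs
  have hHm : Measurable fun ω => (fun s : Iic q => ξ s ω) :=
    measurable_pi_lambda _ fun s => hξ.measurable_particles s
  have hYH := hYm.prodMk hHm
  set A₁ := ENNReal.ofReal (localBound m εM εG (n - (q + 1)) p ((1 + χ) / (χ * Nb : ℕ)))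
  set A₀ := ENNReal.ofReal (localBound m εM εG (n - (q + 1)) p (1 / (χ * Nb : ℕ)))
  have hPYH : IsProbabilityMeasure
      (P.map fun ω => ((fun s => Y s ω), (fun s : Iic q => ξ s ω))) :=
    Measure.isProbabilityMeasure_map hYH.aemeasurable
  have hlast : Measurable fun x : (∀ s : Iic q, Fin (χ * Nb) → E s) => x ⟨q, by simp⟩ :=
    measurable_pi_apply _
  have hR : Measurable fun z : ((∀ t, Obs t) × (∀ s : Iic q, Fin (χ * Nb) → E s)) ×
      (Fin (χ * Nb) → E (q + 1)) =>
      ENNReal.ofReal (|S.ratio z.1.1 n h (q + 1) (empirical z.2) -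
        S.ratio z.1.1 n h q (empirical (z.1.2 ⟨q, by simp⟩))| ^ p) := by
    have h1 := (measurable_ratio_empirical S hh hq (χ * Nb)).comp
      ((measurable_fst.comp measurable_fst).prodMk measurable_snd :
        Measurable fun z : ((∀ t, Obs t) × (∀ s : Iic q, Fin (χ * Nb) → E s)) ×
          (Fin (χ * Nb) → E (q + 1)) => (z.1.1, z.2))
    have hf : Measurable fun z : ((∀ t, Obs t) × (∀ s : Iic q, Fin (χ * Nb) → E s)) ×
          (Fin (χ * Nb) → E (q + 1)) => (z.1.1, z.1.2 ⟨q, by simp⟩) :=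
      (measurable_fst.comp measurable_fst).prodMk (hlast.comp (measurable_snd.comp measurable_fst))
    have h2 := (measurable_ratio_empirical S hh (Nat.le_of_succ_le hq) (χ * Nb)).comp hf
    exact ((continuous_abs.measurable.comp (h1.sub h2)).pow_const p).ennreal_ofReal
  have hdec : Measurable fun z : (∀ t, Obs t) × (∀ s : Iic q, Fin (χ * Nb) → E s) =>
      if D.decision q (z.2 ⟨q, by simp⟩) (z.1 (q + 1)) = true then A₁ else A₀ := by
    have h1 : Measurable fun z : (∀ t, Obs t) × (∀ s : Iic q, Fin (χ * Nb) → E s) =>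
        D.decision q (z.2 ⟨q, by simp⟩) (z.1 (q + 1)) :=
      Measurable.comp (g := fun z : (Fin (χ * Nb) → E q) × Obs (q + 1) => D.decision q z.1 z.2)
        (f := fun z : (∀ t, Obs t) × (∀ s : Iic q, Fin (χ * Nb) → E s) =>
          (z.2 ⟨q, by simp⟩, z.1 (q + 1))) (D.measurable_decision q)
        ((hlast.comp measurable_snd).prodMk ((measurable_pi_apply (q + 1)).comp measurable_fst))
    exact Measurable.ite (h1 (measurableSet_singleton true)) measurable_const measurable_const
  calc _ = ∫⁻ z, ENNReal.ofReal (|S.ratio z.1.1 n h (q + 1) (empirical z.2) -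
          S.ratio z.1.1 n h q (empirical (z.1.2 ⟨q, by simp⟩))| ^ p)
          ∂(P.map fun ω => (((fun s => Y s ω), (fun s : Iic q => ξ s ω)), ξ (q + 1) ω)) := by
        rw [lintegral_map hR (hYH.prodMk (hξ.measurable_particles (q + 1)))]
        rfl
    _ ≤ ∫⁻ z, (if D.decision q (z.2 ⟨q, by simp⟩) (z.1 (q + 1)) = true then A₁ else A₀)
          ∂(P.map fun ω => ((fun s => Y s ω), (fun s : Iic q => ξ s ω))) := by
        rw [hξ.law_succ q, Measure.lintegral_compProd hR]
        refine lintegral_mono fun z => ?_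
        exact lintegral_stepLaw_le hG hM D mode hh hh1 hq z.1 (z.2 ⟨q, by simp⟩) hp
    _ = _ := by
        rw [lintegral_map hdec hYH]
        rfl

/-- The bound on the `L^p` norm of a sampling error that results from subsampling with
probability at most `q`. -/
def mixtureBound (χ Nb : ℕ) (p q : ℝ) : ℝ :=
  cConst p ^ (1 / p) / √((χ * Nb : ℕ) : ℝ) * (q ^ (1 / p) * √χ + (1 - q) ^ (1 / p))

lemma mixtureBound_nonneg {p q : ℝ} (hp : 1 ≤ p) (hq0 : 0 ≤ q) (hq : q ≤ 2 / 3) :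
    0 ≤ mixtureBound χ Nb p q := by
  have := cConst_nonneg hp
  have : 0 ≤ 1 - q := by linarith
  unfold mixtureBound
  positivity

lemma mixture_localBound_le [NeZero χ] [NeZero Nb] (hG : S.RegularG εG) (hM : S.RegularM m εM)
    (k : ℕ) {p q : ℝ} (hp : 1 ≤ p) (hq0 : 0 ≤ q) (hq : q ≤ 2 / 3) :
    q * localBound m εM εG k p ((1 + χ) / (χ * Nb : ℕ)) +
        (1 - q) * localBound m εM εG k p (1 / (χ * Nb : ℕ)) ≤
      (massRatio m εM εG * (1 - minorizationConst m εM εG) ^ (k / m) *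
        mixtureBound χ Nb p q) ^ p := by
  have hp0 : 0 < p := by linarith
  have hχ : (1 : ℝ) ≤ χ := by exact_mod_cast NeZero.one_le
  have hN : (0 : ℝ) < (χ * Nb : ℕ) := by exact_mod_cast NeZero.pos _
  have hF := localFactor_nonneg hG hM k
  obtain ⟨F, hFdef⟩ : ∃ F, F = massRatio m εM εG *
    (1 - minorizationConst m εM εG : ℝ) ^ (k / m) := ⟨_, rfl⟩
  rw [← hFdef] at hF
  have hc := cConst_nonneg hp
  have hq1 : 0 ≤ 1 - q := by linarith
  obtain ⟨N, hNdef⟩ : ∃ N : ℝ, N = ((χ * Nb : ℕ) : ℝ) := ⟨_, rfl⟩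
  rw [← hNdef] at hN
  have split : ∀ v : ℝ, 0 ≤ v → (v / N / 4) ^ (p / 2) = (v / 4) ^ (p / 2) / N ^ (p / 2) :=
    fun v hv => by rw [← Real.div_rpow (by positivity) hN.le]; congr 1; ring
  have eN : √N ^ p = N ^ (p / 2) := by
    rw [Real.sqrt_eq_rpow, ← Real.rpow_mul hN.le]; congr 1; ring
  have ec : (cConst p ^ (1 / p)) ^ p = cConst p := by
    rw [← Real.rpow_mul hc, one_div_mul_cancel hp0.ne', Real.rpow_one]
  rw [← hFdef, Real.mul_rpow hF (mixtureBound_nonneg hp hq0 hq), mixtureBound, ← hNdef,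
    Real.mul_rpow (by positivity) (by positivity), Real.div_rpow (by positivity) (by positivity),
    ec, eN, localBound, localBound, ← hFdef, split _ (by positivity), split _ zero_le_one]
  have key := mixture_moment_le hp hq0 hq hχ
  have hNp : 0 < N ^ (p / 2) := by positivity
  calc _ = F ^ p * ((q * (subgaussianConst p * ((1 + χ) / 4) ^ (p / 2)) +
        (1 - q) * (subgaussianConst p * (1 / 4) ^ (p / 2))) / N ^ (p / 2)) := by ring
    _ ≤ F ^ p * (cConst p * (q ^ (1 / p) * √χ + (1 - q) ^ (1 / p)) ^ p / N ^ (p / 2)) := by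
        gcongr
    _ = _ := by ring

lemma localBound_mono (hG : S.RegularG εG) (hM : S.RegularM m εM) (k : ℕ) {p v w : ℝ}
    (hp : 1 ≤ p) (hv : 0 ≤ v) (hvw : v ≤ w) :
    localBound m εM εG k p v ≤ localBound m εM εG k p w := by
  have hF := localFactor_nonneg hG hM k
  have := subgaussianConst_nonneg hp
  unfold localBound
  gcongr

lemma localBound_nonneg (hG : S.RegularG εG) (hM : S.RegularM m εM) (k : ℕ) {p v : ℝ}
    (hp : 1 ≤ p) (hv : 0 ≤ v) : 0 ≤ localBound m εM εG k p v := by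
  have hF := localFactor_nonneg hG hM k
  have := subgaussianConst_nonneg hp
  unfold localBound
  positivity

lemma measurableSet_subsampled {D : DecisionRule E Obs (χ * Nb)} (hY : ∀ t, Measurable (Y t))
    (hξ : ∀ t, Measurable (ξ t)) (q : ℕ) :
    MeasurableSet {ω | subsampled D Y ξ q ω = true} := by
  cases q with
  | zero => simp [subsampled]
  | succ q =>
    exact ((D.measurable_decision q).comp ((hξ q).prodMk (hY (q + 1))))
      (measurableSet_singleton true)

/-- The conditional bound is a₀ + (a₁ − a₀)·1{δ_q = 1}. As a₀ ≤ a₁, an upper bound on the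
probability of subsampling is enough. -/
lemma lintegral_localError_le [NeZero χ] [NeZero Nb] [IsProbabilityMeasure P]
    (hG : S.RegularG εG) (hM : S.RegularM m εM) {D : DecisionRule E Obs (χ * Nb)}
    {mode : Upsampling} (hξ : IsFilter P S D mode Y ξ) (hh : Measurable h) (hh1 : ∀ x, h x ≤ 1)
    {qu : ℝ} (hqu0 : 0 ≤ qu) (hqu : qu ≤ 2 / 3)
    (hq' : ∀ i, P {ω | subsampled D Y ξ i ω = true} ≤ ENNReal.ofReal qu)
    {q : ℕ} (hq : q ≤ n) {p : ℝ} (hp : 1 ≤ p) :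
    ∫⁻ ω, ENNReal.ofReal (|localError S n h Y ξ q ω| ^ p) ∂P ≤
      ENNReal.ofReal ((massRatio m εM εG * (1 - minorizationConst m εM εG) ^ ((n - q) / m) *
        mixtureBound χ Nb p qu) ^ p) := by
  set a₁ := localBound m εM εG (n - q) p ((1 + χ) / (χ * Nb : ℕ)) with ha₁
  set a₀ := localBound m εM εG (n - q) p (1 / (χ * Nb : ℕ)) with ha₀
  have h0 : 0 ≤ a₀ := localBound_nonneg hG hM _ hp (by positivity)
  have h01 : a₀ ≤ a₁ := localBound_mono hG hM _ hp (by positivity) (by gcongr; simp)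
  have hmeas := measurableSet_subsampled (D := D) hξ.measurable_obs hξ.measurable_particles q
  have h1 : ∫⁻ ω, ENNReal.ofReal (|localError S n h Y ξ q ω| ^ p) ∂P ≤
      ∫⁻ ω, (if subsampled D Y ξ q ω = true then ENNReal.ofReal a₁ else ENNReal.ofReal a₀) ∂P := by
    cases q with
    | zero =>
      simp only [subsampled, Bool.false_eq_true, if_false, lintegral_const, measure_univ, mul_one]
      exact lintegral_localError_zero_le hG hM hξ hh hh1 hp
    | succ q => exact lintegral_localError_succ_le hG hM hξ hh hh1 hq hp
  have h2 : ∀ ω, (if subsampled D Y ξ q ω = true then ENNReal.ofReal a₁ else ENNReal.ofReal a₀) =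
      ENNReal.ofReal a₀ + Set.indicator {ω | subsampled D Y ξ q ω = true}
        (fun _ => ENNReal.ofReal (a₁ - a₀)) ω := fun ω => by
    by_cases hω : subsampled D Y ξ q ω = true
    · simp only [hω, if_true, Set.indicator, Set.mem_ofPred_eq]
      rw [← ENNReal.ofReal_add h0 (by linarith), add_sub_cancel]
    · simp [hω, Set.indicator]
  refine h1.trans ?_
  simp only [h2]
  rw [lintegral_add_left measurable_const, lintegral_const, measure_univ, mul_one,
    lintegral_indicator_const hmeas]
  calc _ ≤ ENNReal.ofReal a₀ + ENNReal.ofReal (a₁ - a₀) * ENNReal.ofReal qu := by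
        gcongr
        exact hq' q
    _ = ENNReal.ofReal (qu * a₁ + (1 - qu) * a₀) := by
        rw [← ENNReal.ofReal_mul (by linarith),
          ← ENNReal.ofReal_add h0 (mul_nonneg (by linarith) hqu0)]
        congr 1; ring
    _ ≤ _ := ENNReal.ofReal_le_ofReal (mixture_localBound_le hG hM _ hp hqu0 hqu)

/-! ### Summation of the local errors in L^p -/

lemma eLpNorm_le_of_lintegral_rpow_le {Z : Ω → ℝ} {p c : ℝ} (hp : 1 ≤ p) (hc : 0 ≤ c)
    (hZ : ∫⁻ ω, ENNReal.ofReal (|Z ω| ^ p) ∂P ≤ ENNReal.ofReal (c ^ p)) :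
    eLpNorm Z (ENNReal.ofReal p) P ≤ ENNReal.ofReal c := by
  have hp0 : 0 < p := by linarith
  rw [eLpNorm_eq_lintegral_rpow_enorm_toReal (by simpa using hp0) ENNReal.ofReal_ne_top,
    ENNReal.toReal_ofReal hp0.le]
  have e : ∀ ω, ‖Z ω‖ₑ ^ p = ENNReal.ofReal (|Z ω| ^ p) := fun ω => by
    rw [← ENNReal.ofReal_rpow_of_nonneg (abs_nonneg _) hp0.le, Real.enorm_eq_ofReal_abs]
  simp only [e]
  calc _ ≤ ENNReal.ofReal (c ^ p) ^ (1 / p) := ENNReal.rpow_le_rpow hZ (by positivity)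
    _ = _ := by
      rw [← ENNReal.ofReal_rpow_of_nonneg hc hp0.le, ← ENNReal.rpow_mul,
        mul_one_div_cancel hp0.ne', ENNReal.rpow_one]

/-- The left side equals m/(εM³ εG^(2m−1)); the factor 2 − εM εG^m ≥ 1 is pure slack. -/
lemma massRatio_mul_div_le (hG : S.RegularG εG) (hM : S.RegularM m εM) :
    massRatio m εM εG * (m / minorizationConst m εM εG) ≤ epsConst m εM εG := by
  obtain ⟨j, rfl⟩ : ∃ j, m = j + 1 := ⟨m - 1, by have := hM.1; omega⟩
  have hεG := hG.1
  have hεM := hM.2.1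
  have h1 := one_le_epsFactor (m := j + 1) hG.1 hG.2.1 hM.2.1 hM.2.2.1
  rw [coe_minorizationConst hG hM, massRatio, epsConst]
  have e : 2 * (j + 1) - 1 = (j + 1) + j := by omega
  rw [e, Nat.add_sub_cancel]
  calc _ = ((j + 1 : ℕ) : ℝ) * 1 / (εM ^ 3 * εG ^ (j + 1 + j)) := by
        field_simp
        ring
    _ ≤ _ := by gcongr

lemma eLpNorm_ratio_sub_le [NeZero χ] [NeZero Nb] [IsProbabilityMeasure P]
    (hG : S.RegularG εG) (hM : S.RegularM m εM) {D : DecisionRule E Obs (χ * Nb)}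
    {mode : Upsampling} (hξ : IsFilter P S D mode Y ξ) (hh : Measurable h) (hh1 : ∀ x, h x ≤ 1)
    {qu : ℝ} (hqu0 : 0 ≤ qu) (hqu : qu ≤ 2 / 3)
    (hq' : ∀ i, P {ω | subsampled D Y ξ i ω = true} ≤ ENNReal.ofReal qu)
    {p : ℝ} (hp : 1 ≤ p) :
    eLpNorm (fun ω => S.ratio (fun t => Y t ω) n h n (empirical (ξ n ω)) -
        S.ratio (fun t => Y t ω) n h 0 S.init) (ENNReal.ofReal p) P ≤
      ENNReal.ofReal (epsConst m εM εG * mixtureBound χ Nb p qu) := by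
  have hT := mixtureBound_nonneg (χ := χ) (Nb := Nb) hp hqu0 hqu
  have hρ1 : (minorizationConst m εM εG : ℝ) ≤ 1 := by
    exact_mod_cast minorizationConst_le_one hG hM
  have hρ0 : (0 : ℝ) < minorizationConst m εM εG := by
    have := hG.1
    have := hM.2.1
    rw [coe_minorizationConst hG hM]
    positivity
  have e : (fun ω => S.ratio (fun t => Y t ω) n h n (empirical (ξ n ω)) -
      S.ratio (fun t => Y t ω) n h 0 S.init) =
      ∑ q ∈ range (n + 1), localError S n h Y ξ q := by
    ext ω
    rw [Finset.sum_apply, sum_localError]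
  rw [e]
  calc _ ≤ ∑ q ∈ range (n + 1), eLpNorm (localError S n h Y ξ q) (ENNReal.ofReal p) P :=
        eLpNorm_sum_le (fun q hq => (measurable_localError hξ.measurable_obs
          hξ.measurable_particles hh (by simpa [Nat.lt_succ_iff] using hq)).aestronglyMeasurable)
          (ENNReal.one_le_ofReal.2 hp)
    _ ≤ ∑ q ∈ range (n + 1), ENNReal.ofReal (massRatio m εM εG *
          (1 - minorizationConst m εM εG) ^ ((n - q) / m) * mixtureBound χ Nb p qu) := by
        refine sum_le_sum fun q hq => ?_
        exact eLpNorm_le_of_lintegral_rpow_le hp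
          (mul_nonneg (localFactor_nonneg hG hM _) hT)
          (lintegral_localError_le hG hM hξ hh hh1 hqu0 hqu hq'
            (by simpa [Nat.lt_succ_iff] using hq) hp)
    _ = ENNReal.ofReal (∑ q ∈ range (n + 1), massRatio m εM εG *
          (1 - minorizationConst m εM εG) ^ ((n - q) / m) * mixtureBound χ Nb p qu) :=
        (ENNReal.ofReal_sum_of_nonneg fun q _ =>
          mul_nonneg (localFactor_nonneg hG hM _) hT).symm
    _ ≤ _ := by
        refine ENNReal.ofReal_le_ofReal ?_
        rw [← sum_mul, ← mul_sum]
        refine mul_le_mul_of_nonneg_right ?_ hT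
        refine le_trans (mul_le_mul_of_nonneg_left ?_ (massRatio_pos hG hM).le)
          (massRatio_mul_div_le hG hM)
        have hs := sum_range_reflect
          (fun k => (1 - minorizationConst m εM εG : ℝ) ^ (k / m)) (n + 1)
        simp only [Nat.add_sub_cancel] at hs
        rw [hs]
        exact sum_pow_div_le hρ0 hρ1 hM.1 (n + 1)

end LocalErrors

/-! ### Reduction to test functions with values in [0, 1] -/

lemma exists_shift_of_mem_Osc1 {F : Type*} [MeasurableSpace F] [Nonempty F] {h : F → ℝ}
    (hh : h ∈ Osc1 F) : ∃ c : ℝ, ∀ x, c ≤ h x ∧ h x ≤ c + 1 := by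
  have h1 : ∀ x y, h x - h y ≤ 1 := fun x y => by
    have := (le_iSup₂ (f := fun x y => ENNReal.ofReal |h x - h y|) x y).trans hh.2
    exact (le_abs_self _).trans (ENNReal.ofReal_le_one.1 this)
  obtain ⟨x₀⟩ := ‹Nonempty F›
  have hb : BddBelow (Set.range h) := ⟨h x₀ - 1, by rintro _ ⟨x, rfl⟩; linarith [h1 x₀ x]⟩
  have : Nonempty F := ⟨x₀⟩
  refine ⟨⨅ x, h x, fun x => ⟨ciInf_le hb x, ?_⟩⟩
  have : h x - 1 ≤ ⨅ x, h x := le_ciInf fun y => by linarith [h1 x y]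
  linarith

/-- Backward functions take values in `ℝ≥0∞`, so h is replaced by h − c; the shift cancels in the
difference of two probability measures. -/
lemma toReal_lintegral_ofReal_sub {F : Type*} [MeasurableSpace F] {h : F → ℝ} (hh : Measurable h)
    {c : ℝ} (hc : ∀ x, c ≤ h x ∧ h x ≤ c + 1) (ν : Measure F) [IsProbabilityMeasure ν] :
    (∫⁻ x, ENNReal.ofReal (h x - c) ∂ν).toReal = ∫ x, h x ∂ν - c := by
  have hi : Integrable h ν := Integrable.of_mem_Icc c (c + 1) hh.aemeasurable (ae_of_all _ hc)
  rw [← integral_eq_lintegral_of_nonneg_ae (ae_of_all _ fun x => sub_nonneg.2 (hc x).1)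
    (hh.sub_const c).aestronglyMeasurable, integral_sub hi (integrable_const c)]
  simp

end ParticleFilter
end

theorem mainTheorem1
    {E : ℕ → Type*} [∀ t, MeasurableSpace (E t)]
    {Obs : ℕ → Type*} [∀ t, MeasurableSpace (Obs t)]
    (S : ParticleFilter.Model E Obs)
    (m : ℕ) (εM εG : ℝ) (hG : S.RegularG εG) (hM : S.RegularM m εM)
    (χ Nb : ℕ) (hχ : 1 ≤ χ) (hNb : 1 ≤ Nb)
    (D : ParticleFilter.DecisionRule E Obs (χ * Nb)) (mode : ParticleFilter.Upsampling)
    {Ω : Type*} [MeasurableSpace Ω] (P : MeasureTheory.Measure Ω)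
    [MeasureTheory.IsProbabilityMeasure P]
    (Y : ∀ t, Ω → Obs t) (ξ : ∀ t, Ω → Fin (χ * Nb) → E t)
    (hξ : ParticleFilter.IsFilter P S D mode Y ξ)
    (qu : ℝ) (hqu0 : 0 ≤ qu) (hqu : qu ≤ 2 / 3)
    (hq : ∀ i, P {ω | ParticleFilter.subsampled D Y ξ i ω = true} ≤ ENNReal.ofReal qu)
    (p : ℝ) (hp : 1 ≤ p)
    (h : ∀ t, E t → ℝ) (hh : ∀ t, h t ∈ ParticleFilter.Osc1 (E t)) :
    ⨆ t, MeasureTheory.eLpNorm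
        (fun ω => ∫ x, h t x ∂(ParticleFilter.empirical (ξ t ω))
          - ∫ x, h t x ∂(S.eta (fun s => Y s ω) t))
        (ENNReal.ofReal p) P
      ≤ ENNReal.ofReal
          (ParticleFilter.epsConst m εM εG * ParticleFilter.cConst p ^ (1 / p)
            / Real.sqrt ((χ * Nb : ℕ) : ℝ)
            * (qu ^ (1 / p) * Real.sqrt χ + (1 - qu) ^ (1 / p))) := by
  have : NeZero χ := ⟨by omega⟩
  have : NeZero Nb := ⟨by omega⟩
  refine iSup_le fun t => ?_
  -- An outcome supplies an observation, and a potential that is not identically zero supplies a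
  -- state.
  obtain ⟨ω₀⟩ : Nonempty Ω := MeasureTheory.nonempty_of_isProbabilityMeasure P
  have hne : Nonempty (E t) := ParticleFilter.nonempty_state S (fun s => Y s ω₀) t
  obtain ⟨c, hc⟩ := ParticleFilter.exists_shift_of_mem_Osc1 (hh t)
  have hm : Measurable fun x => ENNReal.ofReal (h t x - c) :=
    ((hh t).1.sub_const c).ennreal_ofReal
  have key := ParticleFilter.eLpNorm_ratio_sub_le (n := t) hG hM hξ hm
    (fun x => ENNReal.ofReal_le_one.2 (by linarith [(hc x).2])) hqu0 hqu hq hp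
  have e : (fun ω => ∫ x, h t x ∂(ParticleFilter.empirical (ξ t ω))
      - ∫ x, h t x ∂(S.eta (fun s => Y s ω) t)) =
      fun ω => S.ratio (fun s => Y s ω) t (fun x => ENNReal.ofReal (h t x - c)) t
          (ParticleFilter.empirical (ξ t ω)) -
        S.ratio (fun s => Y s ω) t (fun x => ENNReal.ofReal (h t x - c)) 0 S.init := by
    ext ω
    have := ParticleFilter.isProbabilityMeasure_eta (fun s => Y s ω) hG t
    rw [ParticleFilter.ratio_self, ParticleFilter.ratio_zero_init _ _ hm,
      ParticleFilter.toReal_lintegral_ofReal_sub (hh t).1 hc,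
      ParticleFilter.toReal_lintegral_ofReal_sub (hh t).1 hc]
    ring
  rw [e]
  refine key.trans_eq ?_
  rw [ParticleFilter.mixtureBound]
  congr 1
  ring
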